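/- **Setting.** Let $G$ be a finite connected planar graph (parallel edges and loops are allowed) with $m$ edges, given with a planar embedding, and let $G'$ be its dual multigraph: the vertices of $G'$ are the faces of $G$, and every edge of $G$ is an edge of $G'$ joining the two faces on its two sides. Planar embeddings are taken in combinatorial form (a cyclic order of the edge-ends around each vertex, with $|V|-|E|+|F|=2$). An unknown spanning tree $T$ of $G$ is *realized*. A false-positive (FP) oracle with error probability $p\in[0,1/2)$ answers queries "Is edge $e$ realized?"; all answers are independent (also for repeated queries of the same edge); if $e\in T$ the answer is "Yes" with probability $1$; if $e\notin T$ the answer is "Yes" with probability $p$ and "No" with probability $1-p$. **Algorithms.** In a multigraph, a *super-edge* is the set of all edges joining two given distinct vertices, $N(u)$ is the set of super-edges at $u$, and $\deg(u)=|N(u)|$. * $\mathrm{DISCOVER}(\{E_1,\dots,E_k\})$: repeat rounds $i=1,\dots,k$; in step $i$ query the next edge in a fixed cyclic order of $E_i$; return the first edge that is answered "Yes". * $\mathrm{SolveSparseFN}(\Gamma)$: if $\Gamma$ has a single vertex, return $\emptyset$; otherwise let $u$ be a vertex of minimum degree, let $e=\mathrm{DISCOVER}(N(u))$, contract $e$ (deleting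 all resulting loops, i.e. also the edges parallel to $e$) to get $\Gamma'$, and return $\mathrm{SolveSparseFN}(\Gamma')\cup\{e\}$. * $\mathrm{SolvePlanarFP}(G)$: return $E(G)\setminus \mathrm{SolveSparseFN}(G')$, where every answer of the oracle is inverted ("Yes" $\leftrightarrow$ "No") before it is handed to $\mathrm{SolveSparseFN}$. **Theorem.** There is an absolute constant $C$ such that for every such $G$, every planar embedding of $G$ and every spanning tree $T$ of $G$: 1. the edges of $G'$ that correspond to the non-realized edges $E(G)\setminus T$ form a spanning tree of $G'$; 2. for every $p\in[0,1/2)$, every FP oracle with error probability $p$, and every rule for choosing $u$ among the vertices of minimum degree and for ordering the super-edges of $N(u)$ and the edges inside each of them (depending on the current graph), $\mathrm{SolvePlanarFP}(G)$ stops and returns $T$ with probability $1$, and the expected number of queries it makes is at most $C\,m$. -/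

import Mathlib

namespace NoisyConnectivity

open MeasureTheory ProbabilityTheory
open scoped ENNReal

/-! ### Trees in multigraphs

`Graph V E` is Mathlib's type of multigraphs (parallel edges and loops allowed). -/

/-- A multigraph is connected: it has a vertex, and any two vertices are joined by a walk. -/
def Connected {V E : Type*} (G : Graph V E) : Prop :=
  G.vertexSet.Nonempty ∧
    ∀ x ∈ G.vertexSet, ∀ y ∈ G.vertexSet, Relation.ReflTransGen G.Adj x y

/-- A tree: connected and without cycles. No edge lies on a cycle means that the ends of each edge
are no longer joined by a walk once the edge is deleted (in particular there are no loops and no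
parallel edges). -/
def IsTree {V E : Type*} (G : Graph V E) : Prop :=
  Connected G ∧ ∀ e x y, G.IsLink e x y →
    ¬ Relation.ReflTransGen (G.deleteEdges {e}).Adj x y

/-! ### Plane embeddings and duals -/

/-- A (combinatorial) embedding of the multigraph `G` in an oriented surface. `D` is the set of
darts (half-edges): every edge of `G` consists of two darts exchanged by `flip`, every dart `d`
leaves the vertex `vert d`, and `rot` lists the darts leaving each vertex in cyclic order. -/
structure Embedding {V E : Type*} (G : Graph V E) (D : Type*) where
  vert : D → V
  edge : D → E
  flip : Equiv.Perm D
  rot : Equiv.Perm D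
  flip_flip : ∀ d, flip (flip d) = d
  flip_ne : ∀ d, flip d ≠ d
  isLink : ∀ d, G.IsLink (edge d) (vert d) (vert (flip d))
  exists_dart : ∀ e ∈ G.edgeSet, ∃ d, edge d = e
  edge_eq_iff : ∀ d d', edge d = edge d' ↔ d' = d ∨ d' = flip d
  vert_eq_iff : ∀ d d', vert d = vert d' ↔ rot.SameCycle d d'

namespace Embedding

variable {V E D : Type*} {G : Graph V E}

/-- Walking along the boundary of a face: after traversing the dart `d`, continue with the dart
that follows `flip d` in the cyclic order around the vertex where `d` arrives. -/
def facePerm (M : Embedding G D) : Equiv.Perm D := M.flip.trans M.rot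

/-- The faces, given by their boundary walks: the orbits of `facePerm`, and one trivial walk for
every isolated vertex (in a connected graph this happens only for the graph with a single vertex
and no edge, which has one face). -/
def Face (M : Embedding G D) : Type _ :=
  Quotient (Equiv.Perm.SameCycle.setoid M.facePerm) ⊕
    {x : V // x ∈ G.vertexSet ∧ ∀ d, M.vert d ≠ x}

/-- The face on a fixed side of the dart `d`; the face on the other side is `M.face (M.flip d)`. -/
def face (M : Embedding G D) (d : D) : M.Face :=
  Sum.inl (Quotient.mk (Equiv.Perm.SameCycle.setoid M.facePerm) d)

/-- The embedding is planar: `G` is connected and the surface is a sphere (it has Euler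
characteristic `|V| - |E| + |F| = 2`). -/
def IsPlanar (M : Embedding G D) : Prop :=
  Connected G ∧ G.vertexSet.ncard + Nat.card M.Face = G.edgeSet.ncard + 2

/-- The dual multigraph: its vertices are the faces, it has the same edges as `G`, and each edge
joins the two faces on its two sides. -/
def dual (M : Embedding G D) : Graph M.Face E where
  vertexSet := Set.univ
  IsLink e f g := ∃ d, M.edge d = e ∧ M.face d = f ∧ M.face (M.flip d) = g
  edgeSet := G.edgeSet
  isLink_symm := by
    intro e _
    constructor
    rintro f g ⟨d, h, hf, hg⟩
    exact ⟨M.flip d, ((M.edge_eq_iff d (M.flip d)).2 (Or.inr rfl)).symm.trans h, hg,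
      by rw [M.flip_flip, hf]⟩
  eq_or_eq_of_isLink_of_isLink := by
    rintro e x y v w ⟨d, h, rfl, rfl⟩ ⟨d', h', rfl, rfl⟩
    rcases (M.edge_eq_iff d d').1 (h.trans h'.symm) with rfl | rfl
    · exact Or.inl rfl
    · exact Or.inr (by rw [M.flip_flip])
  edge_mem_iff_exists_isLink := by
    intro e
    constructor
    · intro he
      obtain ⟨d, hd⟩ := M.exists_dart e he
      exact ⟨_, _, d, hd, rfl, rfl⟩
    · rintro ⟨_, _, d, rfl, _, _⟩
      exact (M.isLink d).edge_mem
  left_mem_of_isLink := fun _ _ _ _ => Set.mem_univ _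

end Embedding

/-! ### The algorithm SolveSparseFN -/

section SparseFN

variable {V E : Type*}

/-- The super-edge between `u` and `v`: all edges joining them. -/
def superEdge (G : Graph V E) (u v : V) : Set E := {e | G.IsLink e u v}

/-- The neighborhood `N(u)`: the set of all super-edges between `u` and another vertex. -/
def neighborhood (G : Graph V E) (u : V) : Set (Set E) :=
  {S | ∃ v, v ≠ u ∧ G.Adj u v ∧ S = superEdge G u v}

/-- The degree of `u` is the number of super-edges at `u`. -/
noncomputable def degree (G : Graph V E) (u : V) : ℕ := (neighborhood G u).ncard

/-- Delete all loops. -/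
def deleteLoops (G : Graph V E) : Graph V E := G.deleteEdges {e | ∃ x, G.IsLoopAt e x}

open Classical in
/-- Contract the edge `e`, one of whose ends is `u`: both ends of `e` become a single vertex (which
keeps the name `u`), all other edges are kept and re-attached, and the resulting loops (that is,
`e` and the edges parallel to it) are deleted. -/
noncomputable def contract (G : Graph V E) (e : E) (u : V) : Graph V E :=
  deleteLoops (G.map (fun x => if G.Inc e x then u else x))

/-- What the pseudocode leaves open: which vertex of minimum degree is taken, and in which order
the super-edges of its neighborhood, and the edges inside each super-edge, are listed. -/
structure TieBreaking (V E : Type*) where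
  pivot : Graph V E → V
  order : Graph V E → List (List E)
  pivot_mem : ∀ G : Graph V E, G.vertexSet.Finite → G.vertexSet.Nonempty →
    pivot G ∈ G.vertexSet
  pivot_min : ∀ G : Graph V E, G.vertexSet.Finite → ∀ v ∈ G.vertexSet,
    degree G (pivot G) ≤ degree G v
  order_nodup : ∀ G : Graph V E, G.vertexSet.Finite → G.edgeSet.Finite →
    ((order G).map (fun l => {e | e ∈ l})).Nodup ∧ ∀ l ∈ order G, l.Nodup
  mem_order : ∀ G : Graph V E, G.vertexSet.Finite → G.edgeSet.Finite → ∀ S : Set E,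
    S ∈ neighborhood G (pivot G) ↔ ∃ l ∈ order G, {e | e ∈ l} = S

/-- The `j`-th query (`j = 0, 1, …`) of DISCOVER on the sets `E₁, …, Eₖ`: the sets are visited
round-robin, and each visit asks for the next edge of the set in its cyclic order. -/
def discoverQuery (L : List (List E)) (j : ℕ) : Option E :=
  (L[j % L.length]?).bind fun l => l[(j / L.length) % l.length]?

/-- A state of the algorithm: the current (contracted) graph, the set of edges found so far, and
the number of queries already made by the current call of DISCOVER. -/
structure State (V E : Type*) where
  graph : Graph V E
  found : Set E
  asked : ℕ

/-- The algorithm stops when the current graph is a single node. -/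
def State.Halted (s : State V E) : Prop := ∃ v, s.graph.vertexSet = {v}

open Classical in
/-- The edge that is queried in the state `s`. -/
noncomputable def nextQuery (R : TieBreaking V E) (s : State V E) : Option E :=
  if s.Halted then none else discoverQuery (R.order s.graph) s.asked

open Classical in
/-- One query: on the answer "Yes" the edge is added to the output and contracted, and the
algorithm goes on with the contracted graph; on "No" the current call of DISCOVER goes on. -/
noncomputable def step (R : TieBreaking V E) (answer : E → Bool) (s : State V E) : State V E :=
  match nextQuery R s with
  | none => s
  | some e =>
    if answer e = true then
      { graph := contract s.graph e (R.pivot s.graph), found := insert e s.found, asked := 0 }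
    else
      { s with asked := s.asked + 1 }

/-- The state of SolveSparseFN on input `G` after `t` queries, where `a t e` is the oracle's answer
if query number `t` asks for the edge `e`. -/
noncomputable def sparseFNState (R : TieBreaking V E) (G : Graph V E) (a : ℕ → E → Bool) :
    ℕ → State V E
  | 0 => { graph := G, found := ∅, asked := 0 }
  | t + 1 => step R (a t) (sparseFNState R G a t)

/-- The number of queries made by SolveSparseFN (`∞` if it never stops). -/
noncomputable def sparseFNQueries (R : TieBreaking V E) (G : Graph V E) (a : ℕ → E → Bool) :
    ℝ≥0∞ :=
  ⨅ (t : ℕ) (_ : (sparseFNState R G a t).Halted), (t : ℝ≥0∞)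

/-- SolveSparseFN stops and returns the edge set `F`. -/
def SparseFNReturns (R : TieBreaking V E) (G : Graph V E) (a : ℕ → E → Bool) (F : Set E) : Prop :=
  ∃ t, (sparseFNState R G a t).Halted ∧ (sparseFNState R G a t).found = F

end SparseFN

/-! ### The algorithm SolvePlanarFP -/

section PlanarFP

variable {V E D : Type*} {G : Graph V E}

/-- The number of queries made by SolvePlanarFP: it runs SolveSparseFN on the dual graph with all
answers inverted. -/
noncomputable def planarFPQueries (M : Embedding G D) (R : TieBreaking M.Face E)
    (a : ℕ → E → Bool) : ℝ≥0∞ :=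
  sparseFNQueries R M.dual (fun t e => !(a t e))

/-- SolvePlanarFP stops and returns `F`, the complement of the edge set that SolveSparseFN returns
on the dual graph with all answers inverted. -/
def PlanarFPReturns (M : Embedding G D) (R : TieBreaking M.Face E)
    (a : ℕ → E → Bool) (F : Set E) : Prop :=
  ∃ S, SparseFNReturns R M.dual (fun t e => !(a t e)) S ∧ F = G.edgeSet \ S

end PlanarFP

/-! ### The oracle -/

/-- `X t e` is the answer (`true` is "Yes") if query number `t` asks for the edge `e`. All answers
are independent; a realized edge is always answered "Yes", and a non-realized edge is answered
"Yes" with probability `p`. -/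
structure IsFPOracle {V E Ω : Type*} [MeasurableSpace Ω] (μ : Measure Ω) (G H : Graph V E) (p : ℝ)
    (X : ℕ → E → Ω → Bool) : Prop where
  measurable : ∀ t e, Measurable (X t e)
  indep : iIndepFun (fun i : ℕ × E => X i.1 i.2) μ
  realized : ∀ t, ∀ e ∈ H.edgeSet, ∀ᵐ ω ∂μ, X t e ω = true
  not_realized : ∀ t, ∀ e ∈ G.edgeSet \ H.edgeSet, μ.real {ω | X t e ω = true} = p

end NoisyConnectivity

/-! Duality is handled by linear algebra over `ZMod 2`. A function on the vertices of `G` has a cut,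
and a function on the faces has a dual cut. Written as sums over darts, the two are orthogonal
(`sum_cut_mul_dualCut`). If a dual cut lies inside the tree `T`, testing it against the fundamental
cuts of `T` shows that it is empty, so the edges outside `T` connect all faces. Euler's formula says
that there are |F| - 1 of them, so they form a tree.

Every graph met by the algorithm is the dual with a set `F` of non-realized edges contracted
(`IsContraction`). Such a minor has a vertex of degree at most 5. Let `R` contain one edge of each
super-edge, and let n be the number of vertices of the minor. A rank computation gives |R| + 2 ≤ n +
c, where c is the number of components of `G` without `F ∪ R`; these components play the role of the
faces of the minor. If c ≥ 2, each component is bounded by at least three edges of `R`, so 3c ≤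
2|R|. In all cases |R| < 3n (`IsSimpleModulo.ncard_lt`).

One call of DISCOVER with k ≤ 5 super-edges is charged to the edges that it deletes. Let a be the
size of the smallest super-edge containing a non-realized edge. A fixed non-realized edge of it is
queried once in every k * a queries and is recognized with probability at least 1/2 each time, so
about two periods, at most 10a queries, are expected. After inversion a "Yes" is almost surely
correct, and any correct "Yes" deletes at least a edges. The function `potential` makes this exact:
it is at most 10m and drops by at least 1 on average per query (`GoodState.exists_hasDrift`,
`lintegral_cost_le`). Finite expectation gives almost sure termination. With one vertex left, `F`
has |F(G)| - 1 elements, where F(G) is the set of faces, so it contains every non-realized edge. -/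

namespace NoisyConnectivity

open MeasureTheory ProbabilityTheory
open scoped ENNReal

/-! ### Trees and functions with values in `ZMod 2` -/

section Trees

variable {V E : Type*}

lemma ZMod.eq_of_add_eq_zero_two {a b : ZMod 2} (h : a + b = 0) : a = b := by
  revert a b; decide

/-- A property of vertices that is preserved along all edges holds everywhere. -/
lemma Connected.forall_of_adj {K : Graph V E} (hK : Connected K) {P : V → Prop}
    (hP : ∀ x y, K.Adj x y → P x → P y) {x y : V} (hx : x ∈ K.vertexSet) (hy : y ∈ K.vertexSet)
    (h : P x) : P y := by
  have := hK.2 x hx y hy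
  induction this with
  | refl => exact h
  | @tail b c hb hbc ih => exact hP _ _ hbc (ih hbc.left_mem)

lemma Connected.eq_of_adj {α : Type*} {K : Graph V E} (hK : Connected K) {g : V → α}
    (hg : ∀ x y, K.Adj x y → g x = g y) {x y : V} (hx : x ∈ K.vertexSet) (hy : y ∈ K.vertexSet) :
    g x = g y :=
  hK.forall_of_adj (P := fun z => g x = g z) (fun a b hab h => h.trans (hg a b hab)) hx hy rfl

/-- A graph is connected if all functions that are constant along the edges are constant. -/
lemma connected_of_forall_eq {K : Graph V E} (hne : K.vertexSet.Nonempty)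
    (h : ∀ g : V → ZMod 2, (∀ e x y, K.IsLink e x y → g x + g y = 0) →
      ∀ x ∈ K.vertexSet, ∀ y ∈ K.vertexSet, g x = g y) : Connected K := by
  classical
  refine ⟨hne, fun x hx y hy => ?_⟩
  have := h (fun z => if Relation.ReflTransGen K.Adj x z then 1 else 0) ?_ x hx y hy
  · by_contra hxy
    simp [hxy, Relation.ReflTransGen.refl] at this
  · intro e a b hab
    have : Relation.ReflTransGen K.Adj x a ↔ Relation.ReflTransGen K.Adj x b :=
      ⟨fun h => h.tail hab.adj, fun h => h.tail hab.symm.adj⟩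
    simp only [this]
    exact CharTwo.add_self_eq_zero _

/-- The fundamental cut of an edge of a tree. -/
lemma IsTree.exists_cut {H : Graph V E} (hH : IsTree H) {e : E} (he : e ∈ H.edgeSet) :
    ∃ g : V → ZMod 2, (∀ x y, H.IsLink e x y → g x + g y = 1) ∧
      ∀ e' x y, H.IsLink e' x y → e' ≠ e → g x + g y = 0 := by
  classical
  obtain ⟨a, b, hab⟩ := H.exists_isLink_of_mem_edgeSet he
  set r := Relation.ReflTransGen (H.deleteEdges {e}).Adj
  refine ⟨fun z => if r a z then 1 else 0, fun x y hxy => ?_, fun e' x y hxy hne => ?_⟩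
  · have ha : r a a := Relation.ReflTransGen.refl
    have hb : ¬ r a b := hH.2 e a b hab
    rcases hab.eq_and_eq_or_eq_and_eq hxy with ⟨rfl, rfl⟩ | ⟨rfl, rfl⟩ <;> simp [ha, hb]
  · have hl : (H.deleteEdges {e}).Adj x y := ⟨e', by simp [hxy, hne]⟩
    have : r a x ↔ r a y := ⟨fun h => h.tail hl, fun h => h.tail hl.symm⟩
    simp only [this]
    exact CharTwo.add_self_eq_zero _

/-- Ends of an edge. -/
lemma exists_ends (K : Graph V E) : ∃ s t : K.edgeSet → V,
    ∀ e : K.edgeSet, K.IsLink e (s e) (t e) := by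
  choose s t h using fun e : K.edgeSet => K.exists_isLink_of_mem_edgeSet e.2
  exact ⟨s, t, h⟩

open Classical in
/-- The difference along each edge of a function on the vertices that vanishes at `v₀`. -/
noncomputable def difference (K : Graph V E) (v₀ : V) (s t : K.edgeSet → V) :
    ({v // v ∈ K.vertexSet ∧ v ≠ v₀} → ZMod 2) →ₗ[ZMod 2] (K.edgeSet → ZMod 2) where
  toFun g e := (if h : s e ∈ K.vertexSet ∧ s e ≠ v₀ then g ⟨s e, h⟩ else 0) +
    (if h : t e ∈ K.vertexSet ∧ t e ≠ v₀ then g ⟨t e, h⟩ else 0)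
  map_add' g g' := by
    funext e
    simp only [Pi.add_apply]
    split_ifs <;> ring
  map_smul' c g := by
    funext e
    simp only [Pi.smul_apply, smul_eq_mul, RingHom.id_apply]
    split_ifs <;> ring

/-- An element of the kernel, extended by 0 at `v₀`, is constant along edges, hence zero on a
connected graph. Pinning the value at `v₀` removes the constants, so comparing dimensions yields |V|
- 1 ≤ |E|. -/
lemma difference_injective {K : Graph V E} (hK : Connected K) {v₀ : V} (hv₀ : v₀ ∈ K.vertexSet)
    {s t : K.edgeSet → V} (hst : ∀ e : K.edgeSet, K.IsLink e (s e) (t e)) :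
    Function.Injective (difference K v₀ s t) := by
  classical
  rw [injective_iff_map_eq_zero]
  intro g hg
  funext v
  set g' : V → ZMod 2 := fun v => if h : v ∈ K.vertexSet ∧ v ≠ v₀ then g ⟨v, h⟩ else 0 with hg'
  have h1 : ∀ e, g' (s e) + g' (t e) = 0 := fun e => congrFun hg e
  have h2 : ∀ x y, K.Adj x y → g' x = g' y := by
    rintro x y ⟨e, he⟩
    have := ZMod.eq_of_add_eq_zero_two (h1 ⟨e, he.edge_mem⟩)
    rcases he.eq_and_eq_or_eq_and_eq (hst ⟨e, he.edge_mem⟩) with ⟨h, h'⟩ | ⟨h, h'⟩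
    · exact (congrArg g' h).trans (this.trans (congrArg g' h').symm)
    · exact (congrArg g' h).trans (this.symm.trans (congrArg g' h').symm)
  have := hK.eq_of_adj h2 v.2.1 hv₀
  simpa [hg', v.2.1, v.2.2] using this

lemma ncard_vertexSet_sdiff_singleton {K : Graph V E} (hV : K.vertexSet.Finite) {v₀ : V}
    (hv₀ : v₀ ∈ K.vertexSet) :
    Nat.card {v // v ∈ K.vertexSet ∧ v ≠ v₀} + 1 = K.vertexSet.ncard := by
  rw [← Set.ncard_sdiff_singleton_add_one hv₀ hV]
  rfl

lemma Connected.ncard_vertexSet_le {K : Graph V E} (hK : Connected K) (hV : K.vertexSet.Finite)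
    (hE : K.edgeSet.Finite) : K.vertexSet.ncard ≤ K.edgeSet.ncard + 1 := by
  obtain ⟨v₀, hv₀⟩ := hK.1
  obtain ⟨s, t, hst⟩ := exists_ends K
  have : Finite {v // v ∈ K.vertexSet ∧ v ≠ v₀} :=
    (hV.subset (fun v h => h.1 : {v | v ∈ K.vertexSet ∧ v ≠ v₀} ⊆ _)).to_subtype
  have : Finite K.edgeSet := hE.to_subtype
  have := Fintype.ofFinite {v // v ∈ K.vertexSet ∧ v ≠ v₀}
  have := Fintype.ofFinite K.edgeSet
  have h := LinearMap.finrank_le_finrank_of_injective (difference_injective hK hv₀ hst)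
  rw [Module.finrank_fintype_fun_eq_card, Module.finrank_fintype_fun_eq_card,
    ← Nat.card_eq_fintype_card, ← Nat.card_eq_fintype_card] at h
  rw [← ncard_vertexSet_sdiff_singleton hV hv₀, ← Nat.card_coe_set_eq K.edgeSet]
  omega

/-- Every function on the edges of a tree is the difference of a function on the vertices. -/
lemma IsTree.exists_difference_eq {H : Graph V E} (hH : IsTree H) (hE : H.edgeSet.Finite)
    (z : E → ZMod 2) : ∃ g : V → ZMod 2, ∀ e x y, H.IsLink e x y → g x + g y = z e := by
  have := hE.fintype
  choose g h1 h2 using fun e : H.edgeSet => hH.exists_cut e.2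
  -- Superpose the fundamental cuts: that of `e'` changes value only across `e'`.
  refine ⟨fun v => ∑ e : H.edgeSet, z e * g e v, fun e x y hxy => ?_⟩
  rw [← Finset.sum_add_distrib, Finset.sum_eq_single ⟨e, hxy.edge_mem⟩]
  · rw [← mul_add, h1 _ x y hxy, mul_one]
  · intro e' _ hne
    rw [← mul_add, h2 e' e x y hxy (fun h => hne (Subtype.ext h.symm)), mul_zero]
  · simp

/-- On a tree `difference` is also surjective, which gives the inequality opposite to
`Connected.ncard_vertexSet_le`. -/
lemma IsTree.ncard_vertexSet {H : Graph V E} (hH : IsTree H) (hV : H.vertexSet.Finite)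
    (hE : H.edgeSet.Finite) : H.vertexSet.ncard = H.edgeSet.ncard + 1 := by
  classical
  refine le_antisymm (hH.1.ncard_vertexSet_le hV hE) ?_
  obtain ⟨v₀, hv₀⟩ := hH.1.1
  obtain ⟨s, t, hst⟩ := exists_ends H
  have : Finite {v // v ∈ H.vertexSet ∧ v ≠ v₀} :=
    (hV.subset (fun v h => h.1 : {v | v ∈ H.vertexSet ∧ v ≠ v₀} ⊆ _)).to_subtype
  have : Finite H.edgeSet := hE.to_subtype
  have := Fintype.ofFinite {v // v ∈ H.vertexSet ∧ v ≠ v₀}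
  have := Fintype.ofFinite H.edgeSet
  have hsurj : Function.Surjective (difference H v₀ s t) := by
    intro z
    obtain ⟨g, hg⟩ := hH.exists_difference_eq hE (fun e => if h : e ∈ H.edgeSet then z ⟨e, h⟩ else 0)
    -- Adding the constant `g v₀` makes the potential vanish at `v₀` and leaves all differences
    -- unchanged.
    refine ⟨fun v => g v + g v₀, funext fun e => ?_⟩
    have key : ∀ v ∈ H.vertexSet, (if h : v ∈ H.vertexSet ∧ v ≠ v₀ then
        (fun v : {v // v ∈ H.vertexSet ∧ v ≠ v₀} => g v + g v₀) ⟨v, h⟩ else 0) = g v + g v₀ := by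
      intro v hv
      split_ifs with h
      · rfl
      · have : v = v₀ := by by_contra h'; exact h ⟨hv, h'⟩
        rw [this, CharTwo.add_self_eq_zero]
    change (_ : ZMod 2) + _ = _
    rw [key _ (hst e).left_mem, key _ (hst e).right_mem]
    have := hg e _ _ (hst e)
    simp only [Subtype.coe_prop, dite_true, Subtype.coe_eta] at this
    rw [← this]
    linear_combination CharTwo.add_self_eq_zero (g v₀)
  have h := LinearMap.finrank_le_finrank_of_surjective hsurj
  rw [Module.finrank_fintype_fun_eq_card, Module.finrank_fintype_fun_eq_card,
    ← Nat.card_eq_fintype_card, ← Nat.card_eq_fintype_card] at h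
  rw [← ncard_vertexSet_sdiff_singleton hV hv₀, ← Nat.card_coe_set_eq H.edgeSet]
  omega

/-- A connected graph with one vertex more than edges is a tree. -/
lemma Connected.isTree {K : Graph V E} (hK : Connected K) (hV : K.vertexSet.Finite)
    (hE : K.edgeSet.Finite) (h : K.edgeSet.ncard + 1 ≤ K.vertexSet.ncard) : IsTree K := by
  refine ⟨hK, fun e x y hxy hr => ?_⟩
  -- An edge on a cycle could be deleted without disconnecting the graph, leaving too few edges for
  -- `Connected.ncard_vertexSet_le`.
  have hc : Connected (K.deleteEdges {e}) := by
    refine connected_of_forall_eq hK.1 fun g hg a ha b hb => ?_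
    have hgxy : g x = g y := by
      have : ∀ z, Relation.ReflTransGen (K.deleteEdges {e}).Adj x z → g x = g z := by
        intro z hz
        induction hz with
        | refl => rfl
        | tail _ hbc ih =>
          obtain ⟨e', he'⟩ := hbc
          exact ih.trans (ZMod.eq_of_add_eq_zero_two (hg e' _ _ he'))
      exact this y hr
    refine hK.eq_of_adj ?_ ha hb
    rintro a b ⟨e', he'⟩
    by_cases hee : e' = e
    · subst hee
      rcases he'.eq_and_eq_or_eq_and_eq hxy with ⟨rfl, rfl⟩ | ⟨rfl, rfl⟩
      · exact hgxy
      · exact hgxy.symm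
    · exact ZMod.eq_of_add_eq_zero_two (hg e' a b (by simp [he', hee]))
  have h1 := hc.ncard_vertexSet_le hV (hE.subset (by simp))
  have h2 : (K.deleteEdges {e}).edgeSet = K.edgeSet \ {e} := by simp
  have h3 := Set.ncard_sdiff_singleton_add_one hxy.edge_mem hE
  rw [h2] at h1
  have h4 : (K.deleteEdges {e}).vertexSet = K.vertexSet := by simp
  rw [h4] at h1
  omega

end Trees

/-! ### Cuts of a plane graph and of its dual -/

namespace Embedding

variable {V E D : Type*} {G : Graph V E} (M : Embedding G D)

lemma edge_mem (d : D) : M.edge d ∈ G.edgeSet := (M.isLink d).edge_mem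

@[simp] lemma edge_flip (d : D) : M.edge (M.flip d) = M.edge d :=
  ((M.edge_eq_iff d (M.flip d)).2 (Or.inr rfl)).symm

lemma vert_facePerm (d : D) : M.vert (M.facePerm d) = M.vert (M.flip d) :=
  ((M.vert_eq_iff _ _).2 ⟨1, by simp [facePerm]⟩).symm

lemma face_facePerm (d : D) : M.face (M.facePerm d) = M.face d := by
  unfold face
  congr 1
  exact Quotient.sound (s := Equiv.Perm.SameCycle.setoid M.facePerm) ⟨-1, by simp⟩

/-- One of the two darts of an edge. -/
noncomputable def dart (e : G.edgeSet) : D := (M.exists_dart e e.2).choose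

@[simp] lemma edge_dart (e : G.edgeSet) : M.edge (M.dart e) = e := (M.exists_dart e e.2).choose_spec

lemma eq_dart_or_eq_flip_dart {d : D} {e : G.edgeSet} (h : M.edge d = e) :
    d = M.dart e ∨ d = M.flip (M.dart e) :=
  (M.edge_eq_iff _ _).1 ((M.edge_dart e).trans h.symm)

lemma exists_dart_of_isLink {e : E} {x y : V} (h : G.IsLink e x y) :
    ∃ d, M.edge d = e ∧ M.vert d = x ∧ M.vert (M.flip d) = y := by
  obtain ⟨d, rfl⟩ := M.exists_dart e h.edge_mem
  rcases (M.isLink d).eq_and_eq_or_eq_and_eq h with ⟨h1, h2⟩ | ⟨h1, h2⟩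
  · exact ⟨d, rfl, h1, h2⟩
  · exact ⟨M.flip d, M.edge_flip d, h2, by rw [M.flip_flip, h1]⟩

lemma bijective_dart :
    Function.Bijective fun q : G.edgeSet × Bool => if q.2 then M.dart q.1 else M.flip (M.dart q.1) := by
  constructor
  · rintro ⟨e, b⟩ ⟨e', b'⟩ h
    have he : e = e' := by
      have := congrArg M.edge h
      refine Subtype.ext ?_
      cases b <;> cases b' <;> simpa using this
    subst he
    have h1 := M.flip_ne (M.dart e)
    cases b <;> cases b' <;> simp_all [eq_comm]
  · intro d
    rcases M.eq_dart_or_eq_flip_dart (e := ⟨M.edge d, M.edge_mem d⟩) rfl with h | h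
    · exact ⟨(_, true), h.symm⟩
    · exact ⟨(_, false), h.symm⟩

lemma finite_dart (M : Embedding G D) (hE : G.edgeSet.Finite) : Finite D := by
  have := hE.to_subtype
  exact Finite.of_surjective _ M.bijective_dart.2

lemma finite_face (hV : G.vertexSet.Finite) (hE : G.edgeSet.Finite) : Finite M.Face := by
  have := M.finite_dart hE
  have : Finite {x : V // x ∈ G.vertexSet ∧ ∀ d, M.vert d ≠ x} :=
    (hV.subset (fun _ h => h.1 : {x | x ∈ G.vertexSet ∧ ∀ d, M.vert d ≠ x} ⊆ _)).to_subtype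
  unfold Face
  infer_instance

lemma sum_dart [Fintype D] [Fintype G.edgeSet] {α : Type*} [AddCommMonoid α] (f : D → α) :
    ∑ d, f d = ∑ e : G.edgeSet, (f (M.dart e) + f (M.flip (M.dart e))) := by
  rw [← M.bijective_dart.sum_comp, Fintype.sum_prod_type]
  simp

open Classical in
/-- Every edge consists of two darts. -/
lemma card_filter_edge_mem [Fintype D] (hE : G.edgeSet.Finite) {R : Set E} (hR : R ⊆ G.edgeSet) :
    (Finset.univ.filter fun d => M.edge d ∈ R).card = 2 * R.ncard := by
  have := hE.fintype
  rw [Finset.card_filter, M.sum_dart]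
  simp only [M.edge_dart, M.edge_flip]
  rw [Finset.sum_add_distrib, ← two_mul, ← Finset.card_filter, ← Nat.card_coe_set_eq,
    ← Fintype.card_subtype, ← Nat.card_eq_fintype_card]
  congr 1
  exact Nat.card_congr (Equiv.subtypeSubtypeEquivSubtype (fun h => hR h))

/-- The edges on which a function on the vertices changes its value. -/
noncomputable def cut (g : V → ZMod 2) (e : G.edgeSet) : ZMod 2 :=
  g (M.vert (M.dart e)) + g (M.vert (M.flip (M.dart e)))

/-- The edges on which a function on the faces changes its value. -/
noncomputable def dualCut (h : M.Face → ZMod 2) (e : G.edgeSet) : ZMod 2 :=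
  h (M.face (M.dart e)) + h (M.face (M.flip (M.dart e)))

variable {M}

lemma cut_eq (g : V → ZMod 2) {e : G.edgeSet} {d : D} (h : M.edge d = e) :
    M.cut g e = g (M.vert d) + g (M.vert (M.flip d)) := by
  rcases M.eq_dart_or_eq_flip_dart h with rfl | rfl
  · rfl
  · rw [cut, M.flip_flip, add_comm]

lemma dualCut_eq (h : M.Face → ZMod 2) {e : G.edgeSet} {d : D} (hd : M.edge d = e) :
    M.dualCut h e = h (M.face d) + h (M.face (M.flip d)) := by
  rcases M.eq_dart_or_eq_flip_dart hd with rfl | rfl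
  · rfl
  · rw [dualCut, M.flip_flip, add_comm]

lemma cut_eq_of_isLink (g : V → ZMod 2) {e : G.edgeSet} {x y : V} (h : G.IsLink e x y) :
    M.cut g e = g x + g y := by
  obtain ⟨d, hd, rfl, rfl⟩ := M.exists_dart_of_isLink h
  exact cut_eq g hd

/-- Every cut of a graph meets every cut of the dual in an even number of edges. -/
lemma sum_cut_mul_dualCut [Fintype G.edgeSet] (g : V → ZMod 2) (h : M.Face → ZMod 2) :
    ∑ e, M.cut g e * M.dualCut h e = 0 := by
  have := M.finite_dart (Set.toFinite G.edgeSet)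
  have := Fintype.ofFinite D
  have h1 : ∑ e, M.cut g e * M.dualCut h e =
      ∑ d, g (M.vert d) * (h (M.face d) + h (M.face (M.flip d))) := by
    rw [M.sum_dart]
    refine Finset.sum_congr rfl fun e _ => ?_
    rw [cut, dualCut, M.flip_flip]
    ring
  -- Reindexing by `flip` and then by `facePerm` works because `facePerm d` starts where `d` ends
  -- and lies on the same face. The two sums are equal, so they cancel in characteristic 2.
  have h2 : ∑ d, g (M.vert d) * h (M.face (M.flip d)) = ∑ d, g (M.vert d) * h (M.face d) := by
    calc ∑ d, g (M.vert d) * h (M.face (M.flip d))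
        = ∑ d, g (M.vert (M.flip d)) * h (M.face (M.flip (M.flip d))) :=
          (Equiv.sum_comp M.flip (fun d => g (M.vert d) * h (M.face (M.flip d)))).symm
      _ = ∑ d, g (M.vert (M.facePerm d)) * h (M.face (M.facePerm d)) := by
          simp only [M.flip_flip, M.vert_facePerm, M.face_facePerm]
      _ = _ := Equiv.sum_comp M.facePerm (fun d => g (M.vert d) * h (M.face d))
  rw [h1]
  simp only [mul_add, Finset.sum_add_distrib]
  rw [h2, CharTwo.add_self_eq_zero]

/-- The dual of a connected graph is connected. -/
lemma face_eq_of_forall {α : Type*} (hG : Connected G) {h : M.Face → α}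
    (hh : ∀ d, h (M.face d) = h (M.face (M.flip d))) (φ ψ : M.Face) : h φ = h ψ := by
  -- Consecutive darts at a vertex lie on faces separated by a single edge, so `h` is constant
  -- around each vertex. Connectedness of `G` then carries the value from vertex to vertex.
  have hrot : ∀ d, h (M.face (M.rot d)) = h (M.face d) := by
    intro d
    have : M.rot d = M.facePerm (M.flip d) := by simp [facePerm, M.flip_flip]
    rw [this, M.face_facePerm, hh d]
  have hcyc : ∀ d d', M.rot.SameCycle d d' → h (M.face d') = h (M.face d) := by
    rintro d d' ⟨i, rfl⟩
    induction i with
    | zero => rfl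
    | succ n ih => rw [add_comm, zpow_add, zpow_one, Equiv.Perm.mul_apply, hrot, ih]
    | pred n ih =>
      rw [← ih, ← hrot, ← Equiv.Perm.mul_apply, ← zpow_one_add]
      congr 4
      ring
  have key : ∀ d d', h (M.face d) = h (M.face d') := by
    intro d₀ d'
    refine hG.forall_of_adj (P := fun x => ∀ d, M.vert d = x → h (M.face d₀) = h (M.face d))
      ?_ (M.isLink d₀).left_mem (M.isLink d').left_mem ?_ d' rfl
    · rintro x y ⟨e, he⟩ hx d hd
      obtain ⟨d1, -, h1, h2⟩ := M.exists_dart_of_isLink he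
      rw [hx d1 h1, hh d1, hcyc _ _ ((M.vert_eq_iff (M.flip d1) d).1 (h2.trans hd.symm))]
    · intro d hd
      exact (hcyc _ _ ((M.vert_eq_iff d₀ d).1 hd.symm)).symm
  have hiso : ∀ (x : {x : V // x ∈ G.vertexSet ∧ ∀ d, M.vert d ≠ x}), ∀ y ∈ G.vertexSet, y = x := by
    intro x y hy
    refine hG.forall_of_adj (P := fun y => y = x) ?_ x.2.1 hy rfl
    rintro a b ⟨e, he⟩ rfl
    obtain ⟨d, -, h1, -⟩ := M.exists_dart_of_isLink he
    exact absurd h1 (x.2.2 d)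
  have hno : ∀ (x : {x : V // x ∈ G.vertexSet ∧ ∀ d, M.vert d ≠ x}) (d : D), False :=
    fun x d => x.2.2 d (hiso x _ (M.isLink d).left_mem)
  rcases φ with φ | x <;> rcases ψ with ψ | y
  · induction φ using Quotient.inductionOn
    induction ψ using Quotient.inductionOn
    exact key _ _
  · induction φ using Quotient.inductionOn with | _ d => exact (hno y d).elim
  · induction ψ using Quotient.inductionOn with | _ d => exact (hno x d).elim
  · rw [Subtype.ext (hiso y x x.2.1)]

end Embedding

/-! ### The dual spanning tree -/

section DualTree

variable {V E D : Type*} {G H : Graph V E} {M : Embedding G D}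

lemma Embedding.nonempty_face (hG : Connected G) : Nonempty M.Face := by
  obtain ⟨x, hx⟩ := hG.1
  by_cases h : ∃ d, M.vert d = x
  · obtain ⟨d, -⟩ := h
    exact ⟨M.face d⟩
  · push Not at h
    exact ⟨Sum.inr ⟨x, hx, h⟩⟩

lemma isLink_of_spanning (hHG : H.IsSpanningSubgraph G) {e : E} {x y : V} (h : H.IsLink e x y) :
    G.IsLink e x y := hHG.le.isLink_mono h

lemma isLink_spanning_of_mem (hHG : H.IsSpanningSubgraph G) {e : E} {x y : V} (he : e ∈ H.edgeSet)
    (h : G.IsLink e x y) : H.IsLink e x y := by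
  obtain ⟨a, b, hab⟩ := H.exists_isLink_of_mem_edgeSet he
  rcases (isLink_of_spanning hHG hab).eq_and_eq_or_eq_and_eq h with ⟨rfl, rfl⟩ | ⟨rfl, rfl⟩
  · exact hab
  · exact hab.symm

/-- A cut of the dual that contains only edges of a spanning tree is empty. -/
lemma Embedding.dualCut_eq_zero (hE : G.edgeSet.Finite) (hHG : H.IsSpanningSubgraph G)
    (hH : IsTree H) {h : M.Face → ZMod 2}
    (hh : ∀ e : G.edgeSet, (e : E) ∉ H.edgeSet → M.dualCut h e = 0) (e : G.edgeSet) :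
    M.dualCut h e = 0 := by
  by_cases he : (e : E) ∈ H.edgeSet
  · have := hE.fintype
    -- In `G` the fundamental cut of `e` consists of `e` and edges outside the tree, where the dual
    -- cut vanishes. Orthogonality leaves only the term of `e`.
    obtain ⟨g, hg1, hg2⟩ := hH.exists_cut he
    have key := M.sum_cut_mul_dualCut g h
    have hlink : ∀ e' : G.edgeSet, ∃ x y, G.IsLink e' x y :=
      fun e' => G.exists_isLink_of_mem_edgeSet e'.2
    rw [Finset.sum_eq_single e] at key
    · obtain ⟨x, y, hxy⟩ := hlink e
      rwa [cut_eq_of_isLink g hxy, hg1 x y (isLink_spanning_of_mem hHG he hxy), one_mul] at key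
    · intro e' _ hne
      by_cases he' : (e' : E) ∈ H.edgeSet
      · obtain ⟨x, y, hxy⟩ := hlink e'
        rw [cut_eq_of_isLink g hxy, hg2 e' x y (isLink_spanning_of_mem hHG he' hxy)
          (fun h => hne (Subtype.ext h)), zero_mul]
      · rw [hh e' he', mul_zero]
    · simp
  · exact hh e he

lemma connected_dual_restrict (hE : G.edgeSet.Finite) (hG : Connected G)
    (hHG : H.IsSpanningSubgraph G) (hH : IsTree H) :
    Connected (M.dual.restrict (G.edgeSet \ H.edgeSet)) := by
  refine connected_of_forall_eq ?_ ?_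
  · obtain ⟨φ⟩ := M.nonempty_face hG
    exact ⟨φ, Set.mem_univ _⟩
  · intro h hh φ _ ψ _
    refine Embedding.face_eq_of_forall hG (fun d => ?_) φ ψ
    have := Embedding.dualCut_eq_zero hE hHG hH (h := h) (fun e he => ?_) ⟨M.edge d, M.edge_mem d⟩
    · rw [Embedding.dualCut_eq h rfl] at this
      exact ZMod.eq_of_add_eq_zero_two this
    · refine hh e _ _ ⟨⟨e.2, he⟩, ?_⟩
      exact ⟨M.dart e, M.edge_dart e, rfl, rfl⟩

lemma edgeSet_dual_restrict :
    (M.dual.restrict (G.edgeSet \ H.edgeSet)).edgeSet = G.edgeSet \ H.edgeSet := by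
  ext e
  simp [Embedding.dual]

/-- The tree has |V| - 1 edges, and Euler's formula turns |E| - |V| + 1 into |F| - 1. This is where
the sphere enters; orthogonality of cuts and dual cuts holds on every oriented surface. -/
lemma ncard_compl_tree (hV : G.vertexSet.Finite) (hE : G.edgeSet.Finite) (hM : M.IsPlanar)
    (hHG : H.IsSpanningSubgraph G) (hH : IsTree H) :
    (G.edgeSet \ H.edgeSet).ncard + 1 = Nat.card M.Face := by
  have hsub : H.edgeSet ⊆ G.edgeSet := hHG.le.edgeSet_mono
  have hVH : H.vertexSet = G.vertexSet := hHG.vertexSet_eq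
  have h1 := hH.ncard_vertexSet (hVH ▸ hV) (hE.subset hsub)
  have h2 := Set.ncard_sdiff_add_ncard_of_subset hsub hE
  have h3 := hM.2
  rw [hVH] at h1
  omega

/-- The non-realized edges form a spanning tree of the dual. -/
lemma isTree_dual_restrict (hV : G.vertexSet.Finite) (hE : G.edgeSet.Finite) (hM : M.IsPlanar)
    (hHG : H.IsSpanningSubgraph G) (hH : IsTree H) :
    IsTree (M.dual.restrict (G.edgeSet \ H.edgeSet)) := by
  have := M.finite_face hV hE
  refine (connected_dual_restrict hE hM.1 hHG hH).isTree (Set.toFinite _) ?_ ?_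
  · rw [edgeSet_dual_restrict]
    exact hE.sdiff
  · rw [edgeSet_dual_restrict, ncard_compl_tree hV hE hM hHG hH, ← Set.ncard_univ]
    rfl

/-- The edge sets that meet all cuts of the dual evenly are the cuts. -/
lemma Embedding.exists_cut_eq [Fintype G.edgeSet] (hV : G.vertexSet.Finite) (hM : M.IsPlanar)
    (hHG : H.IsSpanningSubgraph G) (hH : IsTree H) (z : G.edgeSet → ZMod 2)
    (hz : ∀ h, ∑ e, z e * M.dualCut h e = 0) : ∃ g, z = M.cut g := by
  classical
  -- Choose `g` whose cut agrees with `z` on the tree. The difference lives on the complementary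
  -- edges and is orthogonal to all dual cuts. The fundamental dual cut of such an edge meets no
  -- other complementary edge, so the difference vanishes there.
  have hE : G.edgeSet.Finite := Set.toFinite _
  obtain ⟨g, hg⟩ := hH.exists_difference_eq (hE.subset hHG.le.edgeSet_mono)
    (fun e => if h : e ∈ G.edgeSet then z ⟨e, h⟩ else 0)
  have hT : ∀ e : G.edgeSet, (e : E) ∈ H.edgeSet → z e = M.cut g e := by
    intro e he
    obtain ⟨x, y, hxy⟩ := H.exists_isLink_of_mem_edgeSet he
    rw [cut_eq_of_isLink g (isLink_of_spanning hHG hxy), hg e x y hxy]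
    simp
  refine ⟨g, funext fun e => ?_⟩
  by_cases he : (e : E) ∈ H.edgeSet
  · exact hT e he
  obtain ⟨h, hh1, hh2⟩ := (isTree_dual_restrict hV hE hM hHG hH).exists_cut
    (e := (e : E)) (by rw [edgeSet_dual_restrict]; exact ⟨e.2, he⟩)
  have key : ∑ e, (z e + M.cut g e) * M.dualCut h e = 0 := by
    simp only [add_mul, Finset.sum_add_distrib]
    rw [hz h, M.sum_cut_mul_dualCut, add_zero]
  have hlink : ∀ e' : G.edgeSet, (e' : E) ∉ H.edgeSet →
      (M.dual.restrict (G.edgeSet \ H.edgeSet)).IsLink e' (M.face (M.dart e'))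
        (M.face (M.flip (M.dart e'))) :=
    fun e' he' => ⟨⟨e'.2, he'⟩, M.dart e', M.edge_dart e', rfl, rfl⟩
  rw [Finset.sum_eq_single e] at key
  · rw [dualCut, hh1 _ _ (hlink e he), mul_one] at key
    exact ZMod.eq_of_add_eq_zero_two key
  · intro e' _ hne
    by_cases he' : (e' : E) ∈ H.edgeSet
    · rw [hT e' he', CharTwo.add_self_eq_zero, zero_mul]
    · rw [dualCut, hh2 e' _ _ (hlink e' he') (fun h => hne (Subtype.ext h)), mul_zero]
  · simp

end DualTree

/-! ### Euler's formula for minors of the dual -/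

section Minors

variable {V E D : Type*} {G H : Graph V E} {M : Embedding G D}

lemma sum_extend_mul {ι R : Type*} [Fintype ι] [Semiring R] {p : ι → Prop} [DecidablePred p]
    (z : {i // p i} → R) (c : ι → R) :
    ∑ i, (if h : p i then z ⟨i, h⟩ else 0) * c i = ∑ i : {i // p i}, z i * c i := by
  have h := Finset.sum_subtype (p := p) (F := inferInstance) (Finset.univ.filter p) (by simp)
    (fun i => (if h : p i then z ⟨i, h⟩ else 0) * c i)
  rw [Finset.sum_filter] at h
  calc _ = ∑ i, if p i then (if h : p i then z ⟨i, h⟩ else 0) * c i else 0 :=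
        Finset.sum_congr rfl fun i _ => by split_ifs <;> simp
    _ = _ := h.trans (Finset.sum_congr rfl fun i _ => by rw [dif_pos i.2])

lemma Embedding.dualCut_sum [Fintype M.Face] [DecidableEq M.Face] (h : M.Face → ZMod 2)
    (e : G.edgeSet) :
    M.dualCut h e = ∑ φ, h φ * M.dualCut (Pi.single φ 1) e := by
  simp only [dualCut, mul_add, Finset.sum_add_distrib]
  congr 1 <;> simp [Pi.single_apply]

/-- The vertices `x` and `y` are joined by a walk that avoids the edges in `S`. -/
def avoidingSetoid (G : Graph V E) (S : Set E) : Setoid V where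
  r := Relation.ReflTransGen (G.deleteEdges S).Adj
  iseqv := ⟨fun _ => Relation.ReflTransGen.refl,
    @fun x y h => by
      induction h with
      | refl => exact Relation.ReflTransGen.refl
      | tail _ h ih => exact Relation.ReflTransGen.head h.symm ih,
    fun h h' => h.trans h'⟩

/-- The component of a vertex after the deletion of the edges in `S`. -/
def component (G : Graph V E) (S : Set E) (v : V) : Quotient (avoidingSetoid G S) :=
  Quotient.mk (avoidingSetoid G S) v

lemma component_eq_of_isLink {S : Set E} {e : E} {x y : V} (h : G.IsLink e x y) (he : e ∉ S) :
    component G S x = component G S y :=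
  Quotient.sound (s := avoidingSetoid G S) (Relation.ReflTransGen.single ⟨e, by simp [h, he]⟩)

/-- The number of edges in `S` is bounded in terms of the number of components left by `S` and
the number of faces. -/
lemma ncard_add_two_le (hV : G.vertexSet.Finite) (hE : G.edgeSet.Finite) (hM : M.IsPlanar)
    (hHG : H.IsSpanningSubgraph G) (hH : IsTree H) {S : Set E} (hS : S ⊆ G.edgeSet) :
    S.ncard + 2 ≤ Nat.card M.Face + (component G S '' G.vertexSet).ncard := by
  classical
  have := hE.fintype
  have := M.finite_face hV hE
  have := Fintype.ofFinite M.Face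
  obtain ⟨φ₀⟩ := M.nonempty_face hM.1
  obtain ⟨v₀, hv₀⟩ := hM.1.1
  set Q := component G S '' G.vertexSet with hQ
  set q₀ := component G S v₀ with hq₀
  have hQfin : Q.Finite := hV.image _
  have hq₀Q : q₀ ∈ Q := ⟨v₀, hv₀, rfl⟩
  have : Finite {q // q ∈ Q ∧ q ≠ q₀} :=
    (hQfin.subset (fun _ h => h.1 : {q | q ∈ Q ∧ q ≠ q₀} ⊆ _)).to_subtype
  have := Fintype.ofFinite {q // q ∈ Q ∧ q ≠ q₀}
  -- `bd` is the boundary map of the dual restricted to `S`, and `cb` sends a function on the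
  -- components of `G` without `S` to its cut. One face and one component are omitted to remove the
  -- trivial dependencies. Once ker `bd` ≤ range `cb`, rank-nullity gives |S| ≤ (|F| - 1) + (c - 1),
  -- with c the number of components.
  let bd : ({e : G.edgeSet // (e : E) ∈ S} → ZMod 2) →ₗ[ZMod 2] ({φ : M.Face // φ ≠ φ₀} → ZMod 2) :=
    { toFun := fun z φ => ∑ e, z e * M.dualCut (Pi.single φ.1 1) e
      map_add' := fun z z' => by
        funext φ
        simp [add_mul, Finset.sum_add_distrib]
      map_smul' := fun c z => by
        funext φ
        simp [mul_assoc, Finset.mul_sum] }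
  let ext : ({q // q ∈ Q ∧ q ≠ q₀} → ZMod 2) → V → ZMod 2 := fun w v =>
    if h : component G S v ∈ Q ∧ component G S v ≠ q₀ then w ⟨component G S v, h⟩ else 0
  let cb : ({q // q ∈ Q ∧ q ≠ q₀} → ZMod 2) →ₗ[ZMod 2] ({e : G.edgeSet // (e : E) ∈ S} → ZMod 2) :=
    { toFun := fun w e => M.cut (ext w) e
      map_add' := fun w w' => by
        funext e
        simp only [Embedding.cut, ext, Pi.add_apply]
        split_ifs <;> ring
      map_smul' := fun c w => by
        funext e
        simp only [Embedding.cut, ext, Pi.smul_apply, smul_eq_mul, RingHom.id_apply]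
        split_ifs <;> ring }
  have hker : LinearMap.ker bd ≤ LinearMap.range cb := by
    intro z hz
    have hz' : ∀ φ, φ ≠ φ₀ → ∑ e, z e * M.dualCut (Pi.single φ 1) e = 0 := fun φ hφ =>
      congrFun (LinearMap.mem_ker.1 hz) ⟨φ, hφ⟩
    have hlin : ∀ h : M.Face → ZMod 2, ∑ e, z e * M.dualCut h e =
        ∑ φ, h φ * ∑ e, z e * M.dualCut (Pi.single φ 1) e := by
      intro h
      simp only [Finset.mul_sum]
      rw [Finset.sum_comm]
      refine Finset.sum_congr rfl fun e _ => ?_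
      rw [Embedding.dualCut_sum, Finset.mul_sum]
      exact Finset.sum_congr rfl fun φ _ => by ring
    have hlin' : ∀ h : M.Face → ZMod 2, ∑ e, z e * M.dualCut h e =
        h φ₀ * ∑ e, z e * M.dualCut (Pi.single φ₀ 1) e := by
      intro h
      rw [hlin, Finset.sum_eq_single φ₀]
      · intro φ _ hφ
        rw [hz' φ hφ, mul_zero]
      · simp
    -- The condition at the omitted face follows from the others, since the dual cut of a constant
    -- function is empty.
    have hφ₀ : ∑ e, z e * M.dualCut (Pi.single φ₀ 1) e = 0 := by
      have := hlin' (fun _ => 1)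
      rw [one_mul] at this
      rw [← this]
      refine Finset.sum_eq_zero fun e _ => ?_
      rw [Embedding.dualCut, CharTwo.add_self_eq_zero, mul_zero]
    obtain ⟨g, hg⟩ := M.exists_cut_eq hV hM hHG hH
      (fun e => if h : (e : E) ∈ S then z ⟨e, h⟩ else 0) (fun h => by
        rw [sum_extend_mul z (M.dualCut h), hlin' h, hφ₀, mul_zero])
    -- The cut of `g` lies inside `S`, so `g` descends to the components.
    have hgS : ∀ e x y, G.IsLink e x y → e ∉ S → g x = g y := by
      intro e x y hxy he
      have := congrFun hg ⟨e, hxy.edge_mem⟩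
      simp only [he, dite_false] at this
      rw [Embedding.cut_eq_of_isLink g hxy] at this
      exact ZMod.eq_of_add_eq_zero_two this.symm
    let w : Quotient (avoidingSetoid G S) → ZMod 2 := Quotient.lift g (by
      intro a b (hab : Relation.ReflTransGen _ a b)
      induction hab with
      | refl => rfl
      | tail _ hbc ih =>
        obtain ⟨e, he⟩ := hbc
        simp only [Graph.deleteEdges_isLink] at he
        exact ih.trans (hgS e _ _ (by tauto) (by tauto)))
    have hw : ∀ v, w (component G S v) = g v := fun v => rfl
    refine ⟨fun q => w q + w q₀, funext fun e => ?_⟩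
    have hext : ∀ v ∈ G.vertexSet, ext (fun q => w q + w q₀) v = g v + w q₀ := by
      intro v hv
      simp only [ext]
      split_ifs with h
      · rw [hw]
      · have : component G S v = q₀ := by
          by_contra h'
          exact h ⟨⟨v, hv, rfl⟩, h'⟩
        rw [← hw, this, CharTwo.add_self_eq_zero]
    have h1 := congrFun hg e
    simp only [e.2, dite_true] at h1
    change M.cut (ext fun q => w q + w q₀) e = z e
    rw [h1, Embedding.cut, hext _ (M.isLink _).left_mem, hext _ (M.isLink _).right_mem,
      Embedding.cut]
    linear_combination CharTwo.add_self_eq_zero (w q₀)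
  have h1 := LinearMap.finrank_range_add_finrank_ker bd
  have h2 := (LinearMap.range bd).finrank_le
  have h3 := Submodule.finrank_mono hker
  have h4 := LinearMap.finrank_range_le cb
  rw [Module.finrank_fintype_fun_eq_card, ← Nat.card_eq_fintype_card] at h1 h2 h4
  have h5 : Nat.card {e : G.edgeSet // (e : E) ∈ S} = S.ncard := by
    rw [← Nat.card_coe_set_eq]
    exact Nat.card_congr (Equiv.subtypeSubtypeEquivSubtype (fun h => hS h))
  have h6 : Nat.card {φ : M.Face // φ ≠ φ₀} + 1 = Nat.card M.Face := by
    have := Set.ncard_sdiff_singleton_add_one (Set.mem_univ φ₀)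
    rw [Set.ncard_univ] at this
    rw [← this, ← Nat.card_coe_set_eq]
    congr 1
    exact Nat.card_congr (Equiv.subtypeEquivRight (by simp))
  have h7 : Nat.card {q // q ∈ Q ∧ q ≠ q₀} + 1 = Q.ncard := by
    rw [← Set.ncard_sdiff_singleton_add_one hq₀Q hQfin]
    rfl
  omega

end Minors

/-! ### Edge bound for simple minors of the dual -/

section MinorDegree

variable {V E D : Type*} {G H : Graph V E} {M : Embedding G D}

/-- The set `R` of edges has no loops and no parallel edges in the graph that arises from the dual
by merging the faces with the same image under `π`. -/
structure IsSimpleModulo (M : Embedding G D) (π : M.Face → M.Face) (R : Set E) : Prop where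
  ne : ∀ d, M.edge d ∈ R → π (M.face d) ≠ π (M.face (M.flip d))
  eq : ∀ d d', M.edge d ∈ R → M.edge d' ∈ R → π (M.face d) = π (M.face d') →
    π (M.face (M.flip d)) = π (M.face (M.flip d')) → M.edge d = M.edge d'

/-- Three edges of a simple graph are needed to meet all cuts evenly. -/
lemma IsSimpleModulo.three_le_card {π : M.Face → M.Face} {R : Set E}
    (hR : IsSimpleModulo M π R) {A : Finset G.edgeSet} (hA : A.Nonempty)
    (hAR : ∀ e ∈ A, (e : E) ∈ R) (hsum : ∀ h : M.Face → ZMod 2, ∑ e ∈ A, M.dualCut (h ∘ π) e = 0) :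
    3 ≤ A.card := by
  classical
  by_contra hcard
  have hpos := hA.card_pos
  have hval : ∀ (x : M.Face) (e : G.edgeSet) (d : D), M.edge d = e →
      M.dualCut ((fun y => if y = x then (1 : ZMod 2) else 0) ∘ π) e =
        (if π (M.face d) = x then 1 else 0) + (if π (M.face (M.flip d)) = x then 1 else 0) :=
    fun x e d hd => Embedding.dualCut_eq _ hd
  -- Testing against the indicator of an end of an edge shows that some other edge of `A` shares
  -- this end. A single edge would thus be a loop, and two edges would be parallel.
  obtain h1 | h2 : A.card = 1 ∨ A.card = 2 := by omega
  · obtain ⟨e, rfl⟩ := Finset.card_eq_one.1 h1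
    have hd := M.edge_dart e
    have hne := hR.ne (M.dart e) (by rw [hd]; exact hAR e (by simp))
    have := hsum (fun y => if y = π (M.face (M.dart e)) then 1 else 0)
    rw [Finset.sum_singleton, hval _ e _ hd] at this
    simp [hne.symm] at this
  · obtain ⟨e, e', hee, rfl⟩ := Finset.card_eq_two.1 h2
    have hd := M.edge_dart e
    set d := M.dart e
    have hdR : M.edge d ∈ R := by rw [hd]; exact hAR e (by simp)
    have heR' : (e' : E) ∈ R := hAR e' (by simp)
    have hne := hR.ne d hdR
    have hd' : ∃ d', M.edge d' = e' ∧ π (M.face d') = π (M.face d) := by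
      have := hsum (fun y => if y = π (M.face d) then 1 else 0)
      rw [Finset.sum_pair hee, hval _ e d hd, hval _ e' _ (M.edge_dart e')] at this
      by_contra hcon
      push Not at hcon
      have h1 := hcon _ (M.edge_dart e')
      have h2 := hcon (M.flip (M.dart e')) (by rw [M.edge_flip, M.edge_dart])
      simp [hne.symm, h1, h2] at this
    obtain ⟨d', hde, hx⟩ := hd'
    have hdR' : M.edge d' ∈ R := by rw [hde]; exact heR'
    have hy : π (M.face (M.flip d')) = π (M.face (M.flip d)) := by
      have := hsum (fun y => if y = π (M.face (M.flip d)) then 1 else 0)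
      rw [Finset.sum_pair hee, hval _ e d hd, hval _ e' _ hde] at this
      by_contra hcon
      simp [hne, hx, hcon] at this
    have := hR.eq d d' hdR hdR' hx.symm hy.symm
    rw [hd, hde] at this
    exact hee (Subtype.ext this)

/-- A simple minor of the dual has fewer than three times as many edges as vertices. -/
lemma IsSimpleModulo.ncard_lt (hV : G.vertexSet.Finite) (hE : G.edgeSet.Finite)
    (hM : M.IsPlanar) (hHG : H.IsSpanningSubgraph G) (hH : IsTree H) {π : M.Face → M.Face}
    {F R : Set E} (hF : F ⊆ G.edgeSet \ H.edgeSet) (hR : R ⊆ G.edgeSet)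
    (hFπ : ∀ d, M.edge d ∈ F → π (M.face d) = π (M.face (M.flip d)))
    (hcard : F.ncard + (Set.range π).ncard = Nat.card M.Face) (hRπ : IsSimpleModulo M π R) :
    R.ncard < 3 * (Set.range π).ncard := by
  classical
  have := hE.fintype
  have := M.finite_face hV hE
  have := M.finite_dart hE
  have := Fintype.ofFinite D
  obtain ⟨v₀, hv₀⟩ := hM.1.1
  have hnpos : 0 < (Set.range π).ncard := by
    obtain ⟨φ⟩ := M.nonempty_face hM.1
    exact (Set.ncard_pos (Set.toFinite _)).2 ⟨_, φ, rfl⟩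
  have hdisj : Disjoint F R := by
    rw [Set.disjoint_left]
    intro e heF heR
    obtain ⟨d, rfl⟩ := M.exists_dart e (hR heR)
    exact hRπ.ne d heR (hFπ d heF)
  have hS : F ∪ R ⊆ G.edgeSet := Set.union_subset (fun e he => (hF he).1) hR
  have hFR : (F ∪ R).ncard = F.ncard + R.ncard :=
    Set.ncard_union_eq hdisj (hE.subset (fun e he => (hF he).1)) (hE.subset hR)
  have heuler := ncard_add_two_le hV hE hM hHG hH hS
  set c := component G (F ∪ R)
  have hQfin : (c '' G.vertexSet).Finite := hV.image _
  set Q := hQfin.toFinset with hQ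
  have hQcard : (c '' G.vertexSet).ncard = Q.card := Set.ncard_eq_toFinset_card _ hQfin
  -- The darts of `R` leaving the component `q`. An edge between two components contributes one dart
  -- to each, so the sizes add up to at most 2|R|.
  let B : Quotient (avoidingSetoid G (F ∪ R)) → Finset D := fun q =>
    Finset.univ.filter fun d => M.edge d ∈ R ∧ c (M.vert d) = q ∧ c (M.vert (M.flip d)) ≠ q
  have hdarts := M.card_filter_edge_mem hE hR
  have hB : ∑ q ∈ Q, (B q).card ≤ 2 * R.ncard := by
    rw [← hdarts, ← Finset.card_biUnion]
    · refine Finset.card_le_card fun d hd => ?_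
      simp only [B, Finset.mem_biUnion, Finset.mem_filter] at hd ⊢
      obtain ⟨_, _, h1, h2, _⟩ := hd
      exact ⟨h1, h2⟩
    · intro q _ q' _ hqq
      rw [Function.onFun, Finset.disjoint_left]
      intro d hd hd'
      simp only [B, Finset.mem_filter] at hd hd'
      exact hqq (hd.2.2.1.symm.trans hd'.2.2.1)
  have hthree : ∀ q ∈ Q, 2 ≤ Q.card → 3 ≤ (B q).card := by
    intro q hq hQ2
    let g : V → ZMod 2 := fun v => if c v = q then 1 else 0
    let A : Finset G.edgeSet := Finset.univ.filter fun e => (e : E) ∈ R ∧ M.cut g e = 1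
    have hz : ∀ a : ZMod 2, a = 0 ∨ a = 1 := by decide
    have hcutS : ∀ e : G.edgeSet, (e : E) ∉ F ∪ R → M.cut g e = 0 := by
      intro e he
      have hl := M.isLink (M.dart e)
      rw [M.edge_dart] at hl
      have : c (M.vert (M.dart e)) = c (M.vert (M.flip (M.dart e))) :=
        component_eq_of_isLink hl he
      simp only [Embedding.cut, g, this]
      exact CharTwo.add_self_eq_zero _
    -- The tree avoids `F`, so if no edge of `R` left `q`, the indicator `g` of `q` would be
    -- constant along the spanning tree, against the existence of a second component.
    have hA : A.Nonempty := by
      by_contra hA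
      rw [Finset.not_nonempty_iff_eq_empty] at hA
      have hconst : ∀ x y, H.Adj x y → g x = g y := by
        rintro x y ⟨e, he⟩
        have heG := isLink_of_spanning hHG he
        rw [← sub_eq_zero, sub_eq_add_neg, ZMod.neg_eq_self_mod_two,
          ← Embedding.cut_eq_of_isLink (M := M) (e := ⟨e, heG.edge_mem⟩) g heG]
        by_cases heR : e ∈ R
        · refine (hz _).resolve_right fun h => ?_
          have : (⟨e, heG.edge_mem⟩ : G.edgeSet) ∈ A := by simp [A, heR, h]
          simp [hA] at this
        · exact hcutS _ (fun h => h.elim (fun h => (hF h).2 he.edge_mem) heR)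
      obtain ⟨q', hq', hqq⟩ := Finset.exists_mem_ne (by omega : 1 < Q.card) q
      obtain ⟨x, hx, hxq⟩ := hQfin.mem_toFinset.1 hq
      obtain ⟨y, hy, hyq⟩ := hQfin.mem_toFinset.1 hq'
      have hVH := hHG.vertexSet_eq
      have := hH.1.eq_of_adj hconst (hVH ▸ hx) (hVH ▸ hy)
      simp [g, hxq, hyq, hqq] at this
    have hA3 : 3 ≤ A.card := by
      -- The cut of `q` lies in `F ∪ R`, and dual cuts of functions `h ∘ π` vanish on `F`.
      -- Orthogonality therefore survives restriction to `A`.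
      refine hRπ.three_le_card hA (fun e he => (Finset.mem_filter.1 he).2.1) fun h => ?_
      rw [← M.sum_cut_mul_dualCut g (h ∘ π), Finset.sum_filter]
      refine Finset.sum_congr rfl fun e _ => ?_
      split_ifs with he
      · rw [he.2, one_mul]
      · by_cases heF : (e : E) ∈ F
        · have : M.dualCut (h ∘ π) e = 0 := by
            simp only [Embedding.dualCut, Function.comp]
            rw [hFπ _ (by rw [M.edge_dart]; exact heF)]
            exact CharTwo.add_self_eq_zero _
          rw [this, mul_zero]
        · by_cases heR : (e : E) ∈ R
          · rw [(hz _).resolve_right fun h => he ⟨heR, h⟩, zero_mul]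
          · rw [hcutS e (fun h => h.elim heF heR), zero_mul]
    refine hA3.trans ?_
    refine (Finset.card_le_card ?_).trans
      (Finset.card_image_le (f := fun d => (⟨M.edge d, M.edge_mem d⟩ : G.edgeSet)) (s := B q))
    intro e he
    obtain ⟨-, heR, hcut⟩ := Finset.mem_filter.1 he
    rw [Finset.mem_image]
    by_cases h1 : c (M.vert (M.dart e)) = q <;>
      by_cases h2 : c (M.vert (M.flip (M.dart e))) = q
    · simp [Embedding.cut, g, h1, h2, CharTwo.add_self_eq_zero] at hcut
    · exact ⟨M.dart e, by simp [B, heR, h1, h2], by simp⟩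
    · exact ⟨M.flip (M.dart e), by simp [B, heR, h1, h2, M.flip_flip], by simp⟩
    · simp [Embedding.cut, g, h1, h2] at hcut
  rw [hFR, hQcard] at heuler
  by_cases hQ2 : 2 ≤ Q.card
  · have h3 : Q.card * 3 ≤ ∑ q ∈ Q, (B q).card := by
      rw [← smul_eq_mul, ← Finset.sum_const]
      exact Finset.sum_le_sum fun q hq => hthree q hq hQ2
    omega
  · omega

end MinorDegree

/-! ### The graphs that occur in the algorithm -/

section Contraction

variable {V E D : Type*} {G H : Graph V E} {M : Embedding G D}

/-- `Γ` arises from the dual graph by contracting the set `F` of non-realized edges (and deleting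
some loops); `π` maps every face to the vertex of `Γ` into which it has been merged. -/
structure IsContraction (M : Embedding G D) (H : Graph V E) (Γ : Graph M.Face E) (F : Set E)
    (π : M.Face → M.Face) : Prop where
  vertexSet_eq : Γ.vertexSet = Set.range π
  isLink_iff : ∀ e x y, x ≠ y → (Γ.IsLink e x y ↔
    ∃ d, M.edge d = e ∧ π (M.face d) = x ∧ π (M.face (M.flip d)) = y)
  edgeSet_subset : Γ.edgeSet ⊆ G.edgeSet
  found_subset : F ⊆ G.edgeSet \ H.edgeSet
  collapse : ∀ d, M.edge d ∈ F → π (M.face d) = π (M.face (M.flip d))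
  card : F.ncard + Γ.vertexSet.ncard = Nat.card M.Face

lemma isContraction_dual : IsContraction M H M.dual ∅ id where
  vertexSet_eq := by simp [Embedding.dual]
  isLink_iff := fun _ _ _ _ => Iff.rfl
  edgeSet_subset := subset_rfl
  found_subset := Set.empty_subset _
  collapse := by simp
  card := by simp [Embedding.dual, Set.ncard_univ]

lemma superEdge_comm (Γ : Graph V E) (x y : V) : superEdge Γ x y = superEdge Γ y x := by
  ext e
  exact Γ.isLink_comm

namespace IsContraction

variable {Γ : Graph M.Face E} {F : Set E} {π : M.Face → M.Face}

lemma ends (h : IsContraction M H Γ F π) {d : D} {x y : M.Face} (hl : Γ.IsLink (M.edge d) x y)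
    (hxy : x ≠ y) : (π (M.face d) = x ∧ π (M.face (M.flip d)) = y) ∨
      (π (M.face d) = y ∧ π (M.face (M.flip d)) = x) := by
  obtain ⟨d', hd', hx, hy⟩ := (h.isLink_iff _ _ _ hxy).1 hl
  rcases (M.edge_eq_iff d' d).1 hd' with rfl | rfl
  · exact Or.inl ⟨hx, hy⟩
  · rw [M.flip_flip]
    exact Or.inr ⟨hy, hx⟩

/-- Some vertex has degree at most five. -/
lemma exists_degree_le (h : IsContraction M H Γ F π) (hV : G.vertexSet.Finite)
    (hE : G.edgeSet.Finite) (hM : M.IsPlanar) (hHG : H.IsSpanningSubgraph G) (hH : IsTree H) :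
    ∃ x ∈ Γ.vertexSet, degree Γ x ≤ 5 := by
  classical
  have := M.finite_face hV hE
  have := M.finite_dart hE
  have := Fintype.ofFinite D
  -- Representatives are chosen as a function of the edge set alone, so a super-edge seen from
  -- either end has the same one.
  obtain ⟨c, hc⟩ : ∃ c : {S : Set E // S.Nonempty} → E, ∀ S, c S ∈ S.1 :=
    ⟨fun S => S.2.some, fun S => S.2.some_mem⟩
  set R : Set E := {e | ∃ S : {S : Set E // S.Nonempty},
    (∃ x y, x ≠ y ∧ S.1 = superEdge Γ x y) ∧ e = c S} with hRdef
  have hRE : R ⊆ G.edgeSet := by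
    rintro e ⟨S, ⟨x, y, -, hS⟩, rfl⟩
    have : c S ∈ superEdge Γ x y := hS ▸ hc S
    exact h.edgeSet_subset (Graph.IsLink.edge_mem this)
  have hends : ∀ d, M.edge d ∈ R → ∃ S : {S : Set E // S.Nonempty}, M.edge d = c S ∧
      S.1 = superEdge Γ (π (M.face d)) (π (M.face (M.flip d))) ∧
      π (M.face d) ≠ π (M.face (M.flip d)) := by
    rintro d ⟨S, ⟨x, y, hxy, hS⟩, hd⟩
    have hl : Γ.IsLink (M.edge d) x y := by
      have : c S ∈ superEdge Γ x y := hS ▸ hc S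
      rw [hd]
      exact this
    refine ⟨S, hd, ?_⟩
    rcases h.ends hl hxy with ⟨h1, h2⟩ | ⟨h1, h2⟩
    · rw [h1, h2]
      exact ⟨hS, hxy⟩
    · rw [h1, h2, superEdge_comm]
      exact ⟨hS, hxy.symm⟩
  have hsimple : IsSimpleModulo M π R := by
    refine ⟨fun d hd => (hends d hd).choose_spec.2.2, fun d d' hd hd' h1 h2 => ?_⟩
    obtain ⟨S, hS1, hS2, -⟩ := hends d hd
    obtain ⟨S', hS1', hS2', -⟩ := hends d' hd'
    have : S = S' := Subtype.ext (by rw [hS2, hS2', h1, h2])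
    rw [hS1, hS1', this]
  have hlt := hsimple.ncard_lt hV hE hM hHG hH h.found_subset hRE h.collapse
    (by rw [← h.vertexSet_eq]; exact h.card)
  rw [← h.vertexSet_eq] at hlt
  have hfin : Γ.vertexSet.Finite := Set.toFinite _
  by_contra hcon
  push Not at hcon
  have hdeg : ∀ x, degree Γ x ≤
      (Finset.univ.filter fun d => M.edge d ∈ R ∧ π (M.face d) = x).card := by
    intro x
    rw [degree]
    have hsub : neighborhood Γ x ⊆ (fun d => superEdge Γ x (π (M.face (M.flip d)))) ''
        (Finset.univ.filter fun d => M.edge d ∈ R ∧ π (M.face d) = x : Finset D) := by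
      rintro S ⟨v, hv, hadj, rfl⟩
      set S' : {S : Set E // S.Nonempty} := ⟨superEdge Γ x v, hadj⟩ with hS'
      have hl : Γ.IsLink (c S') x v := hc S'
      obtain ⟨d, hd, h1, h2⟩ := (h.isLink_iff _ _ _ hv.symm).1 hl
      refine ⟨d, ?_, by simp only [h2]⟩
      simp only [Finset.coe_filter, Finset.mem_univ, true_and, Set.mem_ofPred_eq]
      exact ⟨⟨S', ⟨x, v, hv.symm, rfl⟩, hd⟩, h1⟩
    refine (Set.ncard_le_ncard hsub (Set.toFinite _)).trans ?_
    refine (Set.ncard_image_le (Set.toFinite _)).trans ?_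
    rw [Set.ncard_coe_finset]
  have hdarts := M.card_filter_edge_mem hE hRE
  have hsum : ∑ x ∈ hfin.toFinset, degree Γ x ≤ 2 * R.ncard := by
    rw [← hdarts]
    refine (Finset.sum_le_sum fun x _ => hdeg x).trans ?_
    rw [← Finset.card_biUnion]
    · refine Finset.card_le_card fun d hd => ?_
      simp only [Finset.mem_biUnion, Finset.mem_filter] at hd ⊢
      obtain ⟨_, _, h1, h2, _⟩ := hd
      exact ⟨h1, h2⟩
    · intro x _ y _ hxy
      rw [Function.onFun, Finset.disjoint_left]
      intro d hd hd'
      simp only [Finset.mem_filter] at hd hd'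
      exact hxy (hd.2.2.symm.trans hd'.2.2)
  have hge : hfin.toFinset.card * 6 ≤ ∑ x ∈ hfin.toFinset, degree Γ x := by
    rw [← smul_eq_mul, ← Finset.sum_const]
    exact Finset.sum_le_sum fun x hx => hcon x (hfin.mem_toFinset.1 hx)
  rw [← Set.ncard_eq_toFinset_card _ hfin] at hge
  omega

/-- As long as there are two vertices, some non-realized edge leaves every vertex. -/
lemma exists_isLink (h : IsContraction M H Γ F π) (hE : G.edgeSet.Finite) (hM : M.IsPlanar)
    (hHG : H.IsSpanningSubgraph G) (hH : IsTree H) {u : M.Face} (hu : u ∈ Γ.vertexSet)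
    (hne : Γ.vertexSet ≠ {u}) :
    ∃ v e, v ≠ u ∧ Γ.IsLink e u v ∧ e ∈ G.edgeSet \ H.edgeSet := by
  by_contra hcon
  push Not at hcon
  have hu' := hu
  rw [h.vertexSet_eq] at hu'
  obtain ⟨φ, hφ⟩ := hu'
  refine hne ?_
  rw [h.vertexSet_eq]
  refine Set.eq_singleton_iff_unique_mem.2 ⟨⟨φ, hφ⟩, ?_⟩
  rintro _ ⟨ψ, rfl⟩
  refine (connected_dual_restrict (M := M) hE hM.1 hHG hH).forall_of_adj (P := fun ψ => π ψ = u)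
    ?_ (Set.mem_univ φ) (Set.mem_univ ψ) hφ
  rintro x y ⟨e, he, d, hd, hx, hy⟩ hxu
  by_contra hyu
  refine hcon (π y) e hyu ?_ he
  exact (h.isLink_iff _ _ _ (Ne.symm hyu)).2 ⟨d, hd, by rw [hx, hxu], by rw [hy]⟩

lemma contract_fun_eq {e : E} {u v : V} {Γ : Graph V E} (hl : Γ.IsLink e u v) [DecidableEq V]
    [DecidablePred (Γ.Inc e)] :
    (fun x => if Γ.Inc e x then u else x) = fun x => if x = v then u else x := by
  funext x
  have : Γ.Inc e x ↔ x = u ∨ x = v :=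
    ⟨fun hx => hx.eq_or_eq_of_isLink hl, by rintro (rfl | rfl); exacts [hl.inc_left, hl.inc_right]⟩
  by_cases h1 : x = u <;> by_cases h2 : x = v <;> simp_all

/-- Edges parallel to `e` become loops and are deleted. This loss of a whole super-edge pays for the
queries. -/
lemma edgeSet_contract_subset {e : E} {u v : V} {Γ : Graph V E} (hl : Γ.IsLink e u v) :
    (contract Γ e u).edgeSet ⊆ Γ.edgeSet \ superEdge Γ u v := by
  classical
  intro e' he'
  simp only [contract, deleteLoops, Graph.edgeSet_deleteEdges, Graph.edgeSet_map, Set.mem_sdiff,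
    Set.mem_ofPred_eq, not_exists] at he'
  refine ⟨he'.1, fun hmem => he'.2 u ?_⟩
  exact ⟨u, v, hmem, by simp [hl.inc_left], by simp [hl.inc_right]⟩

/-- Contracting a further non-realized edge. -/
lemma contract (h : IsContraction M H Γ F π) (hV : G.vertexSet.Finite) (hE : G.edgeSet.Finite)
    {e : E} {u v : M.Face} (huv : v ≠ u) (hl : Γ.IsLink e u v) (he : e ∈ G.edgeSet \ H.edgeSet) :
    ∃ π', IsContraction M H (contract Γ e u) (insert e F) π' := by
  classical
  have := M.finite_face hV hE
  set f : M.Face → M.Face := fun x => if x = v then u else x with hf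
  have hcontract : NoisyConnectivity.contract Γ e u = deleteLoops (Γ.map f) := by
    rw [NoisyConnectivity.contract]
    congr 2
    convert contract_fun_eq hl
  have heF : e ∉ F := by
    intro heF
    obtain ⟨d, rfl, h1, h2⟩ := (h.isLink_iff _ _ _ huv.symm).1 hl
    exact huv (by rw [← h1, ← h2, h.collapse d heF])
  have hvert : (deleteLoops (Γ.map f)).vertexSet = f '' Γ.vertexSet := by
    simp [deleteLoops]
  refine ⟨f ∘ π, ?_, ?_, ?_, ?_, ?_, ?_⟩
  · rw [hcontract, hvert, h.vertexSet_eq, Set.range_comp]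
  · intro e' x y hxy
    rw [hcontract, deleteLoops, Graph.deleteEdges_isLink]
    constructor
    · intro hl'
      have hl' : (Γ.map f).IsLink e' x y := by tauto
      obtain ⟨a, b, hab, rfl, rfl⟩ := hl'
      have hne : a ≠ b := fun h => hxy (congrArg f h)
      obtain ⟨d, hd, h1, h2⟩ := (h.isLink_iff _ _ _ hne).1 hab
      exact ⟨d, hd, congrArg f h1, congrArg f h2⟩
    · rintro ⟨d, hd, rfl, rfl⟩
      have hne : π (M.face d) ≠ π (M.face (M.flip d)) := fun h => hxy (congrArg f h)
      have hl' : (Γ.map f).IsLink e' (f (π (M.face d))) (f (π (M.face (M.flip d)))) :=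
        ((h.isLink_iff _ _ _ hne).2 ⟨d, hd, rfl, rfl⟩).map f
      have hloop : e' ∉ {e | ∃ x, (Γ.map f).IsLoopAt e x} := by
        rintro ⟨z, hz⟩
        have h1 := hz.eq_of_inc hl'.inc_left
        have h2 := hz.eq_of_inc hl'.inc_right
        exact hxy (h1.symm.trans h2)
      tauto
  · exact (edgeSet_contract_subset hl).trans (Set.sdiff_subset.trans h.edgeSet_subset)
  · exact Set.insert_subset he h.found_subset
  · intro d hd
    simp only [Function.comp]
    by_cases hde : M.edge d = e
    · rw [← hde] at hl
      rcases h.ends hl huv.symm with ⟨h1, h2⟩ | ⟨h1, h2⟩ <;> simp [h1, h2, hf]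
    · rw [h.collapse d (Set.mem_of_mem_insert_of_ne hd hde)]
  · have himage : f '' Γ.vertexSet = Γ.vertexSet \ {v} := by
      ext x
      constructor
      · rintro ⟨y, hy, rfl⟩
        by_cases hyv : y = v
        · simp only [hf, hyv, if_true]
          exact ⟨hl.left_mem, huv.symm⟩
        · simp only [hf, hyv, if_false]
          exact ⟨hy, hyv⟩
      · rintro ⟨hx, hxv⟩
        exact ⟨x, hx, if_neg hxv⟩
    have h1 := Set.ncard_sdiff_singleton_add_one hl.right_mem (Set.toFinite _)
    have h2 := Set.ncard_insert_of_notMem heF (hE.subset fun e he => (h.found_subset he).1)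
    have h3 := h.card
    rw [hcontract, hvert, himage, h2]
    omega

/-- When a single vertex is left, all non-realized edges have been found. -/
lemma found_eq (h : IsContraction M H Γ F π) (hV : G.vertexSet.Finite) (hE : G.edgeSet.Finite)
    (hM : M.IsPlanar) (hHG : H.IsSpanningSubgraph G) (hH : IsTree H) {v : M.Face}
    (hv : Γ.vertexSet = {v}) : F = G.edgeSet \ H.edgeSet := by
  have h1 := h.card
  rw [hv, Set.ncard_singleton, ← ncard_compl_tree hV hE hM hHG hH] at h1
  exact Set.eq_of_subset_of_ncard_le h.found_subset (by omega) hE.sdiff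

end IsContraction

end Contraction

/-! ### The cost of one call of DISCOVER -/

section Potential

/-- The number of steps after `j` until the residue `r` modulo `c` comes up. -/
def waitingTime (c r j : ℕ) : ℕ := (r + (c - j % c)) % c

lemma waitingTime_lt {c r j : ℕ} (hc : 0 < c) : waitingTime c r j < c := Nat.mod_lt _ hc

lemma waitingTime_succ {c r j : ℕ} (hr : r < c) (hj : j % c ≠ r) :
    waitingTime c r (j + 1) + 1 = waitingTime c r j := by
  have hc : 0 < c := by omega
  have hlt := Nat.mod_lt j hc
  have hval : ∀ x < c, (r + (c - x)) % c = if x ≤ r then r - x else r + (c - x) := by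
    intro x hx
    split_ifs with h
    · rw [show r + (c - x) = (r - x) + c by omega, Nat.add_mod_right, Nat.mod_eq_of_lt (by omega)]
    · exact Nat.mod_eq_of_lt (by omega)
  unfold waitingTime
  rw [Nat.add_mod j 1 c]
  by_cases h1 : j % c + 1 < c
  · have : (j % c + 1 % c) % c = j % c + 1 := by
      rw [Nat.mod_eq_of_lt (by omega : 1 < c), Nat.mod_eq_of_lt h1]
    rw [this, hval _ h1, hval _ hlt]
    split_ifs <;> omega
  · have h2 : j % c + 1 = c := by omega
    have : (j % c + 1 % c) % c = 0 := by
      rcases Nat.lt_or_ge 1 c with h | h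
      · rw [Nat.mod_eq_of_lt h, h2, Nat.mod_self]
      · have : c = 1 := by omega
        subst this
        omega
    rw [this, hval _ hc, hval _ hlt]
    split_ifs <;> omega

variable {V E : Type*}

/-- In the call of DISCOVER at the pivot of `Γ`, there are `k ≤ 5` super-edges, every super-edge
with an edge in `N` has at least `a` edges, and an edge in `N` is queried whenever the number of
earlier queries is congruent to `r` modulo `k * a`. -/
structure IsTarget (R : TieBreaking V E) (N : Set E) (Γ : Graph V E) (k a r : ℕ) : Prop where
  k_le : k ≤ 5
  lt : r < k * a
  le_ncard : a ≤ Γ.edgeSet.ncard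
  total : ∀ j, ∃ e, discoverQuery (R.order Γ) j = some e
  hit : ∀ j, j % (k * a) = r → ∀ e, discoverQuery (R.order Γ) j = some e → e ∈ N
  isLink : ∀ j e, discoverQuery (R.order Γ) j = some e → ∃ v, v ≠ R.pivot Γ ∧
    Γ.IsLink e (R.pivot Γ) v ∧ (e ∈ N → a ≤ (superEdge Γ (R.pivot Γ) v).ncard)

lemma ncard_setOf_mem_list {α : Type*} {l : List α} (h : l.Nodup) : {e | e ∈ l}.ncard = l.length := by
  classical
  rw [← List.toFinset_card_of_nodup h, ← Set.ncard_coe_finset]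
  congr 1
  ext
  simp

/-- The target is an edge of `N` in a shortest list containing such an edge, and `a` is the length
of that list; minimality gives the lower bound on the other super-edges meeting `N`. -/
lemma exists_isTarget (R : TieBreaking V E) {N : Set E} {Γ : Graph V E}
    (hV : Γ.vertexSet.Finite) (hE : Γ.edgeSet.Finite) (hdeg : degree Γ (R.pivot Γ) ≤ 5)
    (hN : ∃ v e, v ≠ R.pivot Γ ∧ Γ.IsLink e (R.pivot Γ) v ∧ e ∈ N) :
    ∃ k a r, IsTarget R N Γ k a r := by
  classical
  obtain ⟨hnodup, hnodup'⟩ := R.order_nodup Γ hV hE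
  have hmem := R.mem_order Γ hV hE
  set L := R.order Γ
  set u := R.pivot Γ
  have hlist : ∀ l ∈ L, ∃ v, v ≠ u ∧ {e | e ∈ l} = superEdge Γ u v ∧ Γ.Adj u v := by
    intro l hl
    obtain ⟨v, h1, h2, h3⟩ := (hmem {e | e ∈ l}).2 ⟨l, hl, rfl⟩
    exact ⟨v, h1, h3, h2⟩
  have hpos : ∀ l ∈ L, 0 < l.length := by
    intro l hl
    obtain ⟨v, -, h, e, he⟩ := hlist l hl
    have : e ∈ {e | e ∈ l} := h ▸ he
    exact List.length_pos_of_mem this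
  have hk : L.length = degree Γ u := by
    rw [degree, ← List.length_map (fun l => {e | e ∈ l}) (as := L), ← ncard_setOf_mem_list hnodup]
    congr 1
    ext S
    rw [hmem]
    simp
  obtain ⟨l₀, hl₀, ⟨e₀, he₀, heN⟩, hmin⟩ : ∃ l ∈ L, (∃ e ∈ l, e ∈ N) ∧
      ∀ l' ∈ L, (∃ e ∈ l', e ∈ N) → l.length ≤ l'.length := by
    have hex : ∃ n, ∃ l ∈ L, (∃ e ∈ l, e ∈ N) ∧ l.length = n := by
      obtain ⟨v, e, hv, he, heN⟩ := hN
      obtain ⟨l, hl, hle⟩ := (hmem (superEdge Γ u v)).1 ⟨v, hv, ⟨e, he⟩, rfl⟩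
      have : e ∈ {e | e ∈ l} := hle ▸ he
      exact ⟨_, l, hl, ⟨e, this, heN⟩, rfl⟩
    obtain ⟨l, hl, h, hlen⟩ := Nat.find_spec hex
    exact ⟨l, hl, h, fun l' hl' h' => hlen ▸ Nat.find_min' hex ⟨l', hl', h', rfl⟩⟩
  obtain ⟨i, hi, hLi⟩ := List.getElem_of_mem hl₀
  obtain ⟨q, hq, hlq⟩ := List.getElem_of_mem he₀
  have hkpos : 0 < L.length := by omega
  have hquery : ∀ j, ∃ l ∈ L, ∃ e ∈ l, discoverQuery L j = some e := by
    intro j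
    have h1 := Nat.mod_lt j hkpos
    refine ⟨L[j % L.length], List.getElem_mem h1, ?_⟩
    have h2 := Nat.mod_lt (j / L.length) (hpos _ (List.getElem_mem h1))
    refine ⟨_, List.getElem_mem h2, ?_⟩
    rw [discoverQuery, List.getElem?_eq_getElem h1, Option.bind_some, List.getElem?_eq_getElem h2]
  -- The target is entry `q` of list number `i`: query `j` asks for it if `j` is `i` modulo the
  -- number of lists and the round `j / L.length` is `q` modulo the length of `l₀`.
  refine ⟨L.length, l₀.length, i + L.length * q, hk ▸ hdeg, ?_, ?_, ?_, ?_, ?_⟩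
  · calc i + L.length * q < L.length + L.length * q := by omega
      _ = L.length * (q + 1) := by ring
      _ ≤ _ := Nat.mul_le_mul_left _ hq
  · obtain ⟨v, -, h, -⟩ := hlist l₀ hl₀
    rw [← ncard_setOf_mem_list (hnodup' l₀ hl₀), h]
    exact Set.ncard_le_ncard (fun e he => Graph.IsLink.edge_mem he) hE
  · intro j
    obtain ⟨l, -, e, -, h⟩ := hquery j
    exact ⟨e, h⟩
  · intro j hj e he
    rw [Nat.mod_mul] at hj
    have h1 : j % L.length = i := by
      have := congrArg (· % L.length) hj
      simpa [Nat.add_mul_mod_self_left, Nat.mod_eq_of_lt hi] using this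
    have h2 : j / L.length % l₀.length = q := by
      rw [h1] at hj
      exact Nat.eq_of_mul_eq_mul_left hkpos (by omega)
    rw [discoverQuery, h1, List.getElem?_eq_getElem hi, Option.bind_some, hLi, h2,
      List.getElem?_eq_getElem hq, hlq] at he
    exact Option.some.inj he ▸ heN
  · intro j e he
    obtain ⟨l, hl, e', he', h⟩ := hquery j
    obtain rfl : e = e' := Option.some.inj (he.symm.trans h)
    obtain ⟨v, hv, hS, -⟩ := hlist l hl
    refine ⟨v, hv, (hS ▸ he' : e ∈ superEdge Γ u v), fun heN' => ?_⟩
    rw [← hS, ncard_setOf_mem_list (hnodup' l hl)]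
    exact hmin l hl ⟨e, he', heN'⟩

open Classical in
/-- A bound for the expected number of remaining queries. -/
noncomputable def potential (R : TieBreaking V E) (N : Set E) (s : State V E) : ℕ :=
  if h : ∃ q : ℕ × ℕ × ℕ, IsTarget R N s.graph q.1 q.2.1 q.2.2 then
    10 * (s.graph.edgeSet.ncard - h.choose.2.1) + 1 +
      waitingTime (h.choose.1 * h.choose.2.1) h.choose.2.2 s.asked + h.choose.1 * h.choose.2.1
  else 10 * s.graph.edgeSet.ncard

/-- The waiting time is at most k * a - 1, so the terms besides 10 * (m - a) add up to at most 2 * k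
* a ≤ 10 * a, by k ≤ 5. The subtraction is not truncated because a ≤ m. Without a target, as in a
halted state, the bound is the default value itself. -/
lemma potential_le {R : TieBreaking V E} {N : Set E} (s : State V E) :
    potential R N s ≤ 10 * s.graph.edgeSet.ncard := by
  unfold potential
  split_ifs with h
  · have ht := h.choose_spec
    generalize h.choose = q at *
    obtain ⟨k, a, r⟩ := q
    have h1 := waitingTime_lt (j := s.asked) (r := r) (Nat.zero_lt_of_lt ht.lt)
    have h2 := Nat.mul_le_mul_right a ht.k_le
    have h3 := ht.le_ncard
    simp only at *
    omega
  · exact le_rfl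

/-- The chosen k, a and r depend on the graph only, so they remain the same while answers are "No".
-/
lemma exists_potential_eq {R : TieBreaking V E} {N : Set E} {Γ : Graph V E}
    (h : ∃ k a r, IsTarget R N Γ k a r) : ∃ k a r, IsTarget R N Γ k a r ∧
      ∀ F j, potential R N ⟨Γ, F, j⟩ =
        10 * (Γ.edgeSet.ncard - a) + 1 + waitingTime (k * a) r j + k * a := by
  have h' : ∃ q : ℕ × ℕ × ℕ, IsTarget R N Γ q.1 q.2.1 q.2.2 := by
    obtain ⟨k, a, r, h⟩ := h
    exact ⟨(k, a, r), h⟩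
  exact ⟨_, _, _, h'.choose_spec, fun F j => dif_pos h'⟩

/-- The state after the answer "Yes" for the edge `e`. -/
noncomputable def State.onYes (R : TieBreaking V E) (s : State V E) (e : E) : State V E :=
  ⟨contract s.graph e (R.pivot s.graph), insert e s.found, 0⟩

/-- The state after the answer "No". -/
def State.onNo (s : State V E) : State V E := ⟨s.graph, s.found, s.asked + 1⟩

lemma step_of_halted {R : TieBreaking V E} {a : E → Bool} {s : State V E} (h : s.Halted) :
    step R a s = s := by
  simp [step, nextQuery, h]

lemma step_of_nextQuery {R : TieBreaking V E} {a : E → Bool} {s : State V E} {e : E}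
    (h : nextQuery R s = some e) :
    step R a s = if a e = true then s.onYes R e else s.onNo := by
  rw [step, h]
  rfl

/-- The potential of a state decreases on average with every query. -/
structure HasDrift (R : TieBreaking V E) (N : Set E) (Good : State V E → Prop)
    (W : State V E → ℕ) (s : State V E) (e : E) : Prop where
  nextQuery_eq : nextQuery R s = some e
  good_onNo : Good s.onNo
  good_onYes : e ∈ N → Good (s.onYes R e)
  onYes_add : e ∈ N → W (s.onYes R e) + 1 ≤ W s
  add_add : e ∈ N → W (s.onYes R e) + W s.onNo + 2 ≤ 2 * W s
  onNo_add : e ∉ N → W s.onNo + 1 ≤ W s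

end Potential

/-! ### Drift of the potential along a run -/

section Drift

variable {V E D : Type*} {G H : Graph V E} {M : Embedding G D}

/-- The states that occur as long as the oracle makes no impossible answers. -/
def GoodState (M : Embedding G D) (H : Graph V E) (s : State M.Face E) : Prop :=
  ∃ π, IsContraction M H s.graph s.found π

lemma GoodState.exists_hasDrift {R : TieBreaking M.Face E} (hV : G.vertexSet.Finite)
    (hE : G.edgeSet.Finite) (hM : M.IsPlanar) (hHG : H.IsSpanningSubgraph G) (hH : IsTree H)
    {s : State M.Face E} (hs : GoodState M H s) (hs' : ¬ s.Halted) :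
    ∃ e ∈ G.edgeSet, HasDrift R (G.edgeSet \ H.edgeSet) (GoodState M H)
      (potential R (G.edgeSet \ H.edgeSet)) s e := by
  have := M.finite_face hV hE
  obtain ⟨Γ, F, j⟩ := s
  obtain ⟨π, h⟩ := hs
  simp only at h
  have hΓV : Γ.vertexSet.Finite := Set.toFinite _
  have hΓE : Γ.edgeSet.Finite := hE.subset h.edgeSet_subset
  obtain ⟨x, hx, hxdeg⟩ := h.exists_degree_le hV hE hM hHG hH
  have hu : R.pivot Γ ∈ Γ.vertexSet := R.pivot_mem Γ hΓV ⟨x, hx⟩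
  have hdeg := (R.pivot_min Γ hΓV x hx).trans hxdeg
  obtain ⟨k, a, r, ht, hpot⟩ := exists_potential_eq (exists_isTarget R hΓV hΓE hdeg
    (h.exists_isLink hE hM hHG hH hu (fun hsing => hs' ⟨_, hsing⟩)))
  obtain ⟨e, he⟩ := ht.total j
  obtain ⟨v, hv, hl, hle⟩ := ht.isLink j e he
  have hlt := waitingTime_lt (r := r) (j := j + 1) (Nat.zero_lt_of_lt ht.lt)
  -- A correct "Yes", for the target or for any other edge, deletes a super-edge with at least `a`
  -- edges.
  have hyes : e ∈ G.edgeSet \ H.edgeSet →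
      potential R (G.edgeSet \ H.edgeSet) (State.onYes R ⟨Γ, F, j⟩ e) ≤
        10 * (Γ.edgeSet.ncard - a) := by
    intro heN
    refine (potential_le _).trans (Nat.mul_le_mul_left _ ?_)
    have h1 := Set.ncard_le_ncard (IsContraction.edgeSet_contract_subset hl) hΓE.sdiff
    have h2 := Set.ncard_sdiff_add_ncard_of_subset
      (fun e he => Graph.IsLink.edge_mem he : superEdge Γ (R.pivot Γ) v ⊆ Γ.edgeSet) hΓE
    have h3 := hle heN
    change (NoisyConnectivity.contract Γ e (R.pivot Γ)).edgeSet.ncard ≤ _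
    omega
  refine ⟨e, h.edgeSet_subset hl.edge_mem, ?_, ?_, ?_, ?_, ?_, ?_⟩
  · simp only [nextQuery, hs', if_false]
    exact he
  · exact ⟨π, h⟩
  · exact fun heN => h.contract hV hE hv hl heN
  · intro heN
    have := hyes heN
    rw [hpot]
    omega
  · intro heN
    have := hyes heN
    simp only [State.onNo]
    rw [hpot, hpot]
    by_cases hj : j % (k * a) = r
    · omega
    · have := waitingTime_succ ht.lt hj
      omega
  · intro heN
    simp only [State.onNo]
    rw [hpot, hpot]
    have := waitingTime_succ ht.lt (fun hj => heN (ht.hit j hj e he))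
    omega

end Drift

/-! ### The expected number of queries -/

section Cost

variable {V E : Type*}

open Classical in
/-- The number of queries among the next `n` steps from the state `s`, where `a i` holds the
answers in step `i` and `r` steps have been made before. -/
noncomputable def cost (R : TieBreaking V E) (a : ℕ → E → Bool) : ℕ → ℕ → State V E → ℝ≥0∞
  | 0, _, _ => 0
  | n + 1, r, s => if s.Halted then 0 else 1 + cost R a n (r + 1) (step R (a r) s)

lemma cost_le_succ (R : TieBreaking V E) (a : ℕ → E → Bool) (n r : ℕ) (s : State V E) :
    cost R a n r s ≤ cost R a (n + 1) r s := by
  induction n generalizing r s with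
  | zero => exact zero_le
  | succ n ih =>
    rw [cost, cost]
    split_ifs
    · exact le_rfl
    · gcongr
      exact ih _ _

lemma le_cost (R : TieBreaking V E) (G : Graph V E) (a : ℕ → E → Bool) (n r : ℕ)
    (h : ∀ i < n, ¬ (sparseFNState R G a (r + i)).Halted) :
    (n : ℝ≥0∞) ≤ cost R a n r (sparseFNState R G a r) := by
  induction n generalizing r with
  | zero => simp
  | succ n ih =>
    have h1 := ih (r + 1) (fun i hi => by
      rw [add_assoc, add_comm 1 i]
      exact h (i + 1) (by omega))
    rw [cost, if_neg (by simpa using h 0 (by omega)), Nat.cast_add, Nat.cast_one, add_comm]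
    gcongr
    exact h1

/-- The truncated costs increase with `n` and have an explicit recursion, so a bound uniform in `n`
passes to the expectation by monotone convergence. -/
lemma sparseFNQueries_le (R : TieBreaking V E) (G : Graph V E) (a : ℕ → E → Bool) :
    sparseFNQueries R G a ≤ ⨆ n, cost R a n 0 (sparseFNState R G a 0) := by
  classical
  by_cases h : ∃ t, (sparseFNState R G a t).Halted
  · refine (iInf₂_le (Nat.find h) (Nat.find_spec h)).trans ?_
    refine le_trans (le_cost R G a _ 0 fun i hi => ?_) (le_iSup (fun n => cost R a n 0 (sparseFNState R G a 0)) (Nat.find h))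
    rw [zero_add]
    exact Nat.find_min h hi
  · push Not at h
    refine le_trans le_top (le_of_eq ?_)
    symm
    rw [iSup_eq_top]
    intro b hb
    obtain ⟨n, hn⟩ := ENNReal.exists_nat_gt hb.ne
    exact ⟨n, hn.trans_le (le_cost R G a n 0 fun i _ => h _)⟩

lemma exists_halted_of_sparseFNQueries_lt {R : TieBreaking V E} {G : Graph V E}
    {a : ℕ → E → Bool} (h : sparseFNQueries R G a < ⊤) : ∃ t, (sparseFNState R G a t).Halted := by
  by_contra hcon
  push Not at hcon
  simp [sparseFNQueries, hcon] at h

end Cost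

/-! ### Expected cost from independence and drift -/

section Expectation

variable {V E Ω : Type*}

/-- The events that depend only on the answers from time `r` on. -/
@[reducible]
def futureSigma (Y : ℕ → E → Ω → Bool) (r : ℕ) : MeasurableSpace Ω :=
  ⨆ i ∈ {i : ℕ × E | r ≤ i.1}, MeasurableSpace.comap (Y i.1 i.2) ⊤

lemma futureSigma_succ_le (Y : ℕ → E → Ω → Bool) (r : ℕ) :
    futureSigma Y (r + 1) ≤ futureSigma Y r :=
  biSup_mono fun _ hi => (Nat.le_succ r).trans hi

lemma measurableSet_futureSigma (Y : ℕ → E → Ω → Bool) (r : ℕ) (e : E) (b : Bool) :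
    MeasurableSet[futureSigma Y r] {ω | Y r e ω = b} := by
  have h : MeasurableSpace.comap (Y r e) ⊤ ≤ futureSigma Y r :=
    le_biSup (fun i : ℕ × E => MeasurableSpace.comap (Y i.1 i.2) ⊤) (i := (r, e)) (le_refl r)
  exact h _ ⟨{b}, trivial, rfl⟩

/-- The state determines the next query, so the recursion branches on one answer at time `r` and
then reads only later ones. For a fixed state at time `r + 1`, the remaining cost is thus
independent of the answer at time `r`. -/
lemma measurable_cost (R : TieBreaking V E) (Y : ℕ → E → Ω → Bool) (n r : ℕ) (s : State V E) :
    Measurable[futureSigma Y r] fun ω => cost R (fun t e => Y t e ω) n r s := by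
  classical
  induction n generalizing r s with
  | zero => exact measurable_const
  | succ n ih =>
    have ih' := fun s' => (ih (r + 1) s').mono (futureSigma_succ_le Y r) le_rfl
    simp only [cost]
    split_ifs with hs
    · exact measurable_const
    · refine Measurable.const_add ?_ 1
      cases hq : nextQuery R s with
      | none =>
        have : ∀ ω, step R (fun e => Y r e ω) s = s := fun ω => by rw [step, hq]
        simp only [this]
        exact ih' s
      | some e =>
        have : (fun ω => cost R (fun t e => Y t e ω) n (r + 1) (step R (fun e => Y r e ω) s)) =
            fun ω => if Y r e ω = true then cost R (fun t e => Y t e ω) n (r + 1) (s.onYes R e)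
              else cost R (fun t e => Y t e ω) n (r + 1) s.onNo := by
          funext ω
          rw [step_of_nextQuery hq]
          split_ifs <;> rfl
        rw [this]
        exact Measurable.ite (measurableSet_futureSigma Y r e true) (ih' _) (ih' _)

variable [MeasurableSpace Ω]

/-- An oracle whose positive answers are always right and that finds every element of `N` with
probability at least `1 / 2`. -/
structure IsFNOracle (μ : Measure Ω) (A N : Set E) (Y : ℕ → E → Ω → Bool) : Prop where
  measurable : ∀ t e, Measurable (Y t e)
  indep : iIndepFun (fun i : ℕ × E => Y i.1 i.2) μ
  le_half : ∀ t, ∀ e ∈ N, μ {ω | Y t e ω = false} ≤ 1 / 2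
  eq_false : ∀ t, ∀ e ∈ A \ N, ∀ᵐ ω ∂μ, Y t e ω = false

lemma IsFNOracle.futureSigma_le {μ : Measure Ω} {A N : Set E} {Y : ℕ → E → Ω → Bool}
    (hY : IsFNOracle μ A N Y) (r : ℕ) : futureSigma Y r ≤ ‹MeasurableSpace Ω› :=
  iSup₂_le fun i _ => (hY.measurable i.1 i.2).comap_le

lemma IsFNOracle.lintegral_indicator_mul {μ : Measure Ω} {A N : Set E} {Y : ℕ → E → Ω → Bool}
    (hY : IsFNOracle μ A N Y) (r : ℕ) (e : E) (b : Bool) {f : Ω → ℝ≥0∞}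
    (hf : Measurable[futureSigma Y (r + 1)] f) :
    ∫⁻ ω, {ω | Y r e ω = b}.indicator 1 ω * f ω ∂μ = μ {ω | Y r e ω = b} * ∫⁻ ω, f ω ∂μ := by
  have hle : ∀ i : ℕ × E, MeasurableSpace.comap (Y i.1 i.2) ⊤ ≤ ‹MeasurableSpace Ω› :=
    fun i => (hY.measurable i.1 i.2).comap_le
  have hind : Indep (MeasurableSpace.comap (Y r e) ⊤) (futureSigma Y (r + 1)) μ := by
    have := indep_iSup_of_disjoint hle ((iIndepFun_iff_iIndep _ _ _).1 hY.indep)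
      (S := {((r, e) : ℕ × E)}) (T := {i : ℕ × E | r + 1 ≤ i.1}) (by simp)
    simpa [futureSigma] using this
  have hmeas : Measurable[MeasurableSpace.comap (Y r e) ⊤]
      ({ω | Y r e ω = b}.indicator (1 : Ω → ℝ≥0∞)) :=
    (measurable_from_top (f := ({b} : Set Bool).indicator (1 : Bool → ℝ≥0∞))).comp
      (comap_measurable (Y r e))
  rw [lintegral_mul_eq_lintegral_mul_lintegral_of_independent_measurableSpace (hle (r, e))
    (hY.futureSigma_le (r + 1)) hind hmeas hf, lintegral_indicator_one]
  exact hle (r, e) _ ⟨{b}, trivial, rfl⟩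

/-- The mean is affine in the probability `p` of "No". The hypotheses bound it by `v - 1` at `p = 0`
and at `p = 1 / 2`, hence in between. -/
lemma average_le {p q : ℝ≥0∞} (hpq : q + p = 1) (hp : p ≤ 1 / 2) {y n v : ℕ} (h1 : y + 1 ≤ v)
    (h2 : y + n + 2 ≤ 2 * v) : 1 + (q * y + p * n) ≤ v := by
  have hp' : p ≠ ⊤ := fun h => by simp [h] at hpq
  have hq' : q ≠ ⊤ := fun h => by simp [h] at hpq
  lift p to NNReal using hp'
  lift q to NNReal using hq'
  have hpq' : (q : ℝ) + p = 1 := by exact_mod_cast hpq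
  have hp2 : (p : ℝ) ≤ 1 / 2 := by
    have h := ENNReal.toReal_mono (by simp) hp
    simpa using h
  have h1' : (y : ℝ) + 1 ≤ v := by exact_mod_cast h1
  have h2' : (y : ℝ) + n + 2 ≤ 2 * v := by exact_mod_cast h2
  have hp0 : (0 : ℝ) ≤ p := p.2
  have key : (1 : ℝ) + (q * y + p * n) ≤ v := by
    have hq : (q : ℝ) = 1 - p := by linarith
    rw [hq]
    nlinarith [mul_nonneg (by linarith : (0 : ℝ) ≤ 1 - 2 * p) (by linarith : (0 : ℝ) ≤ v - (y + 1)),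
      mul_nonneg hp0 (by linarith : (0 : ℝ) ≤ 2 * v - (y + n + 2))]
  exact_mod_cast key

/-- If the potential `W` has a negative drift, it bounds the expected number of queries. -/
lemma lintegral_cost_le {μ : Measure Ω} [IsProbabilityMeasure μ] {R : TieBreaking V E}
    {A N : Set E} {Y : ℕ → E → Ω → Bool} (hY : IsFNOracle μ A N Y) {Good : State V E → Prop}
    {W : State V E → ℕ} (hW : ∀ s, Good s → ¬ s.Halted → ∃ e ∈ A, HasDrift R N Good W s e)
    (n r : ℕ) {s : State V E} (hs : Good s) :
    ∫⁻ ω, cost R (fun t e => Y t e ω) n r s ∂μ ≤ W s := by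
  classical
  induction n generalizing r s with
  | zero => simp [cost]
  | succ n ih =>
    by_cases hs' : s.Halted
    · simp [cost, hs']
    obtain ⟨e, heA, hd⟩ := hW s hs hs'
    have hmeas : ∀ s', Measurable[futureSigma Y (r + 1)]
        fun ω => cost R (fun t e => Y t e ω) n (r + 1) s' := measurable_cost R Y n (r + 1)
    have hset : ∀ b, MeasurableSet {ω | Y r e ω = b} := fun b =>
      hY.futureSigma_le r _ (measurableSet_futureSigma Y r e b)
    simp only [cost, hs', if_false]
    rw [lintegral_add_left measurable_const, lintegral_const, measure_univ, mul_one]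
    by_cases heN : e ∈ N
    · have hsplit : ∀ ω, cost R (fun t e => Y t e ω) n (r + 1) (step R (fun e => Y r e ω) s) =
          {ω | Y r e ω = true}.indicator 1 ω *
              cost R (fun t e => Y t e ω) n (r + 1) (s.onYes R e) +
            {ω | Y r e ω = false}.indicator 1 ω *
              cost R (fun t e => Y t e ω) n (r + 1) s.onNo := by
        intro ω
        rw [step_of_nextQuery hd.nextQuery_eq]
        cases h : Y r e ω <;> simp [h]
      simp only [hsplit]
      rw [lintegral_add_left, hY.lintegral_indicator_mul r e true (hmeas _),
        hY.lintegral_indicator_mul r e false (hmeas _)]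
      · have hpq : μ {ω | Y r e ω = true} + μ {ω | Y r e ω = false} = 1 := by
          rw [← prob_add_prob_compl (μ := μ) (hset true)]
          congr 2
          ext ω
          simp
        refine le_trans ?_ (average_le hpq (hY.le_half r e heN) (hd.onYes_add heN)
          (hd.add_add heN))
        gcongr
        · exact ih (r + 1) (hd.good_onYes heN)
        · exact ih (r + 1) hd.good_onNo
      · exact (measurable_one.indicator (hset true)).mul
          ((hmeas _).mono (hY.futureSigma_le _) le_rfl)
    · have hae : ∀ᵐ ω ∂μ, cost R (fun t e => Y t e ω) n (r + 1) (step R (fun e => Y r e ω) s) =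
          cost R (fun t e => Y t e ω) n (r + 1) s.onNo := by
        filter_upwards [hY.eq_false r e ⟨heA, heN⟩] with ω hω
        rw [step_of_nextQuery hd.nextQuery_eq]
        simp [hω]
      rw [lintegral_congr_ae hae]
      calc 1 + ∫⁻ ω, cost R (fun t e => Y t e ω) n (r + 1) s.onNo ∂μ
          ≤ 1 + (W s.onNo : ℝ≥0∞) := by
            gcongr
            exact ih (r + 1) hd.good_onNo
        _ ≤ W s := by
            have := hd.onNo_add heN
            rw [add_comm]
            exact_mod_cast this

/-- A pathwise statement: for any fixed answers without a wrong "Yes", every state of the run is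
good. -/
lemma good_sparseFNState {R : TieBreaking V E} {A N : Set E} {Good : State V E → Prop}
    {W : State V E → ℕ} (hW : ∀ s, Good s → ¬ s.Halted → ∃ e ∈ A, HasDrift R N Good W s e)
    {G : Graph V E} (hG : Good ⟨G, ∅, 0⟩) {a : ℕ → E → Bool}
    (ha : ∀ t, ∀ e ∈ A \ N, a t e = false) (t : ℕ) : Good (sparseFNState R G a t) := by
  induction t with
  | zero => exact hG
  | succ t ih =>
    rw [sparseFNState]
    by_cases hs : (sparseFNState R G a t).Halted
    · rwa [step_of_halted hs]
    · obtain ⟨e, heA, hd⟩ := hW _ ih hs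
      rw [step_of_nextQuery hd.nextQuery_eq]
      split_ifs with h
      · by_cases heN : e ∈ N
        · exact hd.good_onYes heN
        · simp [ha t e ⟨heA, heN⟩] at h
      · exact hd.good_onNo

end Expectation

/-! ### Correctness and query bound of SolvePlanarFP -/

section Main

variable {V E D Ω : Type*} [MeasurableSpace Ω] {G H : Graph V E}

/-- Inverting the answers of a false-positive oracle. -/
lemma IsFPOracle.isFNOracle {μ : Measure Ω} [IsProbabilityMeasure μ] {p : ℝ}
    {X : ℕ → E → Ω → Bool} (hX : IsFPOracle μ G H p X) (hp : p < 1 / 2) :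
    IsFNOracle μ G.edgeSet (G.edgeSet \ H.edgeSet) (fun t e ω => !(X t e ω)) where
  measurable t e := (measurable_from_top (f := not)).comp (hX.measurable t e)
  indep := hX.indep.comp (fun _ => not) (fun _ => measurable_from_top)
  le_half t e he := by
    have h := hX.not_realized t e he
    have h1 : {ω | (!(X t e ω)) = false} = {ω | X t e ω = true} := by
      ext ω
      simp
    rw [h1, ← ENNReal.ofReal_toReal (measure_ne_top μ _), ← Measure.real, h]
    refine (ENNReal.ofReal_le_ofReal hp.le).trans (le_of_eq ?_)
    rw [ENNReal.ofReal_div_of_pos (by norm_num)]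
    simp
  eq_false t e he := by
    have heH : e ∈ H.edgeSet := by
      by_contra h
      exact he.2 ⟨he.1, h⟩
    filter_upwards [hX.realized t e heH] with ω hω
    simp [hω]

/-- The expected number of queries of `SolvePlanarFP`, and its correctness. -/
lemma planarFP_correct {M : Embedding G D} (hV : G.vertexSet.Finite) (hE : G.edgeSet.Finite)
    (hM : M.IsPlanar) (hHG : H.IsSpanningSubgraph G) (hH : IsTree H) (R : TieBreaking M.Face E)
    {p : ℝ} (hp : p < 1 / 2) {μ : Measure Ω} [IsProbabilityMeasure μ] {X : ℕ → E → Ω → Bool}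
    (hX : IsFPOracle μ G H p X) :
    (∀ᵐ ω ∂μ, PlanarFPReturns M R (fun t e => X t e ω) H.edgeSet) ∧
      ∫⁻ ω, planarFPQueries M R (fun t e => X t e ω) ∂μ ≤ 10 * (G.edgeSet.ncard : ℝ≥0∞) := by
  have hY := hX.isFNOracle hp
  set Y : ℕ → E → Ω → Bool := fun t e ω => !(X t e ω)
  have hdrift : ∀ s, GoodState M H s → ¬ s.Halted → ∃ e ∈ G.edgeSet,
      HasDrift R (G.edgeSet \ H.edgeSet) (GoodState M H) (potential R (G.edgeSet \ H.edgeSet)) s e :=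
    fun s hs hs' => hs.exists_hasDrift hV hE hM hHG hH hs'
  have hgood : GoodState M H ⟨M.dual, ∅, 0⟩ := ⟨id, isContraction_dual⟩
  have hmeas : ∀ n, Measurable fun ω => cost R (fun t e => Y t e ω) n 0 ⟨M.dual, ∅, 0⟩ := fun n =>
    (measurable_cost R Y n 0 _).mono (hY.futureSigma_le 0) le_rfl
  have hsup : ∫⁻ ω, ⨆ n, cost R (fun t e => Y t e ω) n 0 ⟨M.dual, ∅, 0⟩ ∂μ ≤
      10 * (G.edgeSet.ncard : ℝ≥0∞) := by
    rw [lintegral_iSup hmeas (monotone_nat_of_le_succ fun n ω => cost_le_succ R _ n 0 _)]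
    refine iSup_le fun n => (lintegral_cost_le hY hdrift n 0 hgood).trans ?_
    exact_mod_cast potential_le (R := R) (N := G.edgeSet \ H.edgeSet) ⟨M.dual, ∅, 0⟩
  constructor
  -- Termination is a consequence of the query bound: a variable with finite expectation is almost
  -- surely finite.
  · have hfin : ∀ᵐ ω ∂μ, ⨆ n, cost R (fun t e => Y t e ω) n 0 ⟨M.dual, ∅, 0⟩ < ⊤ :=
      ae_lt_top (Measurable.iSup hmeas)
        (hsup.trans_lt (ENNReal.mul_lt_top (by simp) (by simp))).ne
    have hans : ∀ᵐ ω ∂μ, ∀ t, ∀ e ∈ G.edgeSet \ (G.edgeSet \ H.edgeSet), Y t e ω = false := by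
      rw [ae_all_iff]
      intro t
      rw [ae_ball_iff (hE.subset Set.sdiff_subset).countable]
      exact hY.eq_false t
    filter_upwards [hfin, hans] with ω hω1 hω2
    obtain ⟨t, ht⟩ := exists_halted_of_sparseFNQueries_lt
      ((sparseFNQueries_le R M.dual fun t e => Y t e ω).trans_lt hω1)
    obtain ⟨π, hπ⟩ := good_sparseFNState hdrift hgood hω2 t
    have ht' := ht
    obtain ⟨v, hv⟩ := ht'
    refine ⟨_, ⟨t, ht, hπ.found_eq hV hE hM hHG hH hv⟩, ?_⟩
    rw [Set.sdiff_sdiff_cancel_left hHG.le.edgeSet_mono]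
  · exact (lintegral_mono fun ω => sparseFNQueries_le R M.dual _).trans hsup

end Main

end NoisyConnectivity

theorem mainTheorem6 :
    ∃ C : ℕ, ∀ (V E D : Type*) (G H : Graph V E) (M : NoisyConnectivity.Embedding G D),
      G.vertexSet.Finite → G.edgeSet.Finite → M.IsPlanar →
      H.IsSpanningSubgraph G → NoisyConnectivity.IsTree H →
      NoisyConnectivity.IsTree (M.dual.restrict (G.edgeSet \ H.edgeSet)) ∧
      ∀ (R : NoisyConnectivity.TieBreaking M.Face E) (p : ℝ), 0 ≤ p → p < 1 / 2 →
        ∀ (Ω : Type*) [MeasurableSpace Ω] (μ : MeasureTheory.Measure Ω)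
          [MeasureTheory.IsProbabilityMeasure μ] (X : ℕ → E → Ω → Bool),
          NoisyConnectivity.IsFPOracle μ G H p X →
          (∀ᵐ ω ∂μ, NoisyConnectivity.PlanarFPReturns M R (fun t e => X t e ω) H.edgeSet) ∧
          ∫⁻ ω, NoisyConnectivity.planarFPQueries M R (fun t e => X t e ω) ∂μ
            ≤ (C : ENNReal) * (G.edgeSet.ncard : ENNReal) := by
  refine ⟨10, fun V E D G H M hV hE hM hHG hH =>
    ⟨NoisyConnectivity.isTree_dual_restrict hV hE hM hHG hH, ?_⟩⟩
  intro R p _ hp Ω _ μ _ X hX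
  exact_mod_cast NoisyConnectivity.planarFP_correct hV hE hM hHG hH R hp hX
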